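/- Fix $n\ge 1$ and let $H$ be the affine Hecke algebra of type $GL_n$ over $\mathbb Z[t^{\pm1}]$, with generators $T_1,\dots,T_{n-1},X_1^{\pm1},\dots,X_n^{\pm1}$ and relations $T_i^2=(t-1)T_i+t$; $T_iT_{i+1}T_i=T_{i+1}T_iT_{i+1}$; $T_iT_j=T_jT_i$ for $|i-j|>1$; $X_iX_j=X_jX_i$; $T_iX_iT_i=tX_{i+1}$; $T_iX_j=X_jT_i$ for $j\notin\{i,i+1\}$. For $w\in S_n$ with length $\ell(w)$ and reduced expression $w=s_{i_1}\cdots s_{i_k}$ put $T_w=T_{i_1}\cdots T_{i_k}$, and for $\mu\in\mathbb Z^n$ put $X^\mu=X_1^{\mu_1}\cdots X_n^{\mu_n}$. Let $\mathbf 1_0=\sum_{w\in S_n}T_w$ and $\varpi_\ell=\varepsilon_1+\dots+\varepsilon_\ell$. Let $S_{n,\mu}$ be the stabilizer of $\mu$ in $S_n$ (acting by permuting coordinates, $w\varepsilon_k=\varepsilon_{w(k)}$), let $\mathbf 1_{\varpi_\ell}=\sum_{w\in S_{n,\varpi_\ell}}T_w$, and let $H_{n,\mu}$ be the subalgebra of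 $H$ generated by the $T_w$ with $w\in S_{n,\mu}$. For $\ell\in[n]=\{1,\dots,n\}$ let $B(\varpi_\ell)$ be the set of columns $C=(c_1<\dots<c_\ell)$ with entries in $[n]$, and let $u_C\in S_n$ send $1,\dots,\ell$ to $c_1,\dots,c_\ell$ and $\ell+1,\dots,n$ to the elements of $[n]\setminus C$ in increasing order. Write $T=C_r\otimes\dots\otimes C_1$ for the filling with columns $C_r,\dots,C_1$ from left to right; it is called semistandard if its entries weakly increase from left to right along every row. Let $X^T=\prod_i X_i^{c_i}$, where $c_i$ is the number of entries of $T$ equal to $i$. Every element $h$ of the subalgebra $H_n$ generated by $T_1,\dots,T_{n-1}$ is uniquely $h=\sum_{E\in B(\varpi_\ell)}T_{u_E}h_E$ with $h_E\in H_{n,\varpi_\ell}$. Define $\Psi_T\in H_n$, for sequences of columns $T$, recursively: for a single column $C\in B(\varpi_\ell)$, $$\Psi_C=t^{\ell(u_C)}(T_{u_C^{-1}})^{-1}\mathbf 1_{\varpi_\ell};$$ if $C\in B(\varpi_\ell)$ and $\Psi_S=\sum_{E\in B(\varpi_\ell)}T_{u_E}h_{E,S}$ with $h_{E,S}\in H_{n,\varpi_\ell}$,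 then $$\Psi_{C\otimes S}=t^{\ell(u_C)}(T_{u_C^{-1}})^{-1}h_{C,S}.$$ For the empty filling put $\Psi_\emptyset=\mathbf 1_0$. **Theorem.** Let $1\le\ell_1\le\dots\le\ell_r\le n$ and $T\in B(\varpi_{\ell_r})\otimes\dots\otimes B(\varpi_{\ell_1})$. (a) If $T$ is not semistandard, then $\Psi_T=0$. (b) For every $\ell\in[n]$, $\displaystyle \Psi_T X^{\varpi_\ell}=\sum_{C\in B(\varpi_\ell)}X^C\,\Psi_{C\otimes T}$. (c) For every $\lambda\in\mathbb Z_{\ge0}^n$ with $\lambda_1\ge\dots\ge\lambda_n$, $\displaystyle \mathbf 1_0X^\lambda=\sum_{T\in B(\lambda)}X^T\,\Psi_T$ in $H$, where $B(\lambda)$ is the set of semistandard Young tableaux of shape $\lambda$ with entries in $[n]$. -/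

import Mathlib

namespace HeckeLift

noncomputable section

/-! ### The symmetric group

Letters, rows and columns are numbered from `0`: `j : Fin n` stands for the letter `j + 1` of
`{1, …, n}`, and `i : Fin (n - 1)` stands for the index `i + 1` of `{1, …, n - 1}`. -/

/-- The letter `i`, for an index `i` of a simple transposition. -/
def lo {n : ℕ} (i : Fin (n - 1)) : Fin n := ⟨i, by omega⟩

/-- The letter `i + 1`, for an index `i` of a simple transposition. -/
def hi {n : ℕ} (i : Fin (n - 1)) : Fin n := ⟨i + 1, by omega⟩

/-- The simple transposition `s_i = (i, i + 1)`. -/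
def simple {n : ℕ} (i : Fin (n - 1)) : Equiv.Perm (Fin n) := Equiv.swap (lo i) (hi i)

/-- The product `s_{i_1} ⋯ s_{i_k}` of a word in the simple transpositions. -/
def wordProd {n : ℕ} (a : List (Fin (n - 1))) : Equiv.Perm (Fin n) := (a.map simple).prod

/-- The length of `w`: the smallest length of a word for `w`. -/
def len {n : ℕ} (w : Equiv.Perm (Fin n)) : ℕ :=
  sInf {k | ∃ a : List (Fin (n - 1)), wordProd a = w ∧ a.length = k}

/-- `a` is a reduced expression for `w`. -/
def IsReduced {n : ℕ} (w : Equiv.Perm (Fin n)) (a : List (Fin (n - 1))) : Prop :=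
  wordProd a = w ∧ a.length = len w

theorem exists_word {n : ℕ} (w : Equiv.Perm (Fin n)) :
    ∃ a : List (Fin (n - 1)), wordProd a = w := by
  cases n with
  | zero => exact ⟨[], Subsingleton.elim _ _⟩
  | succ m =>
    have hw : w ∈ Submonoid.closure
        (Set.range fun i : Fin m => Equiv.swap i.castSucc i.succ) := by
      rw [Equiv.Perm.mclosure_swap_castSucc_succ]; trivial
    induction hw using Submonoid.closure_induction with
    | mem x hx =>
      obtain ⟨i, rfl⟩ := hx
      exact ⟨[i], by simp only [wordProd, List.map_cons, List.map_nil, List.prod_singleton]; rfl⟩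
    | one => exact ⟨[], rfl⟩
    | mul x y _ _ hx hy =>
      obtain ⟨a, rfl⟩ := hx
      obtain ⟨b, rfl⟩ := hy
      exact ⟨a ++ b, by simp [wordProd]⟩

theorem exists_reduced {n : ℕ} (w : Equiv.Perm (Fin n)) :
    ∃ a : List (Fin (n - 1)), IsReduced w a := by
  obtain ⟨a, ha⟩ := exists_word w
  exact Nat.sInf_mem (s := {k | ∃ a : List (Fin (n - 1)), wordProd a = w ∧ a.length = k})
    ⟨a.length, a, ha, rfl⟩

/-- The action of `S_n` on `ℤ^n` by permuting coordinates, so that `w ε_k = ε_{w k}`. -/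
def act {n : ℕ} (w : Equiv.Perm (Fin n)) (μ : Fin n → ℤ) : Fin n → ℤ := fun i => μ (w⁻¹ i)

/-- The fundamental weight `ϖ_ℓ = ε_1 + ⋯ + ε_ℓ`. -/
def fundWt (n ℓ : ℕ) : Fin n → ℤ := fun i => if (i : ℕ) < ℓ then 1 else 0

/-! ### The affine Hecke algebra of type `GL_n` -/

/-- The ground ring `ℤ[t, t⁻¹]`. -/
abbrev R : Type := LaurentPolynomial ℤ

/-- The parameter `t`. -/
def t : R := LaurentPolynomial.T 1

/-- The generators `T_i`, `X_j` and `X_j⁻¹`. -/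
inductive Gen (n : ℕ) : Type
  | T (i : Fin (n - 1)) : Gen n
  | X (j : Fin n) : Gen n
  | Xinv (j : Fin n) : Gen n

/-- The generator `T_i` in the free algebra. -/
abbrev fT {n : ℕ} (i : Fin (n - 1)) : FreeAlgebra R (Gen n) := FreeAlgebra.ι R (Gen.T i)

/-- The generator `X_j` in the free algebra. -/
abbrev fX {n : ℕ} (j : Fin n) : FreeAlgebra R (Gen n) := FreeAlgebra.ι R (Gen.X j)

/-- The generator `X_j⁻¹` in the free algebra. -/
abbrev fXinv {n : ℕ} (j : Fin n) : FreeAlgebra R (Gen n) := FreeAlgebra.ι R (Gen.Xinv j)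

/-- The defining relations of the affine Hecke algebra. -/
inductive Rel (n : ℕ) : FreeAlgebra R (Gen n) → FreeAlgebra R (Gen n) → Prop
  | quad (i : Fin (n - 1)) : Rel n (fT i * fT i) ((t - 1) • fT i + t • 1)
  | braid (i j : Fin (n - 1)) (h : (j : ℕ) = i + 1) :
      Rel n (fT i * fT j * fT i) (fT j * fT i * fT j)
  | far (i j : Fin (n - 1)) (h : (i : ℕ) + 1 < j ∨ (j : ℕ) + 1 < i) :
      Rel n (fT i * fT j) (fT j * fT i)
  | mul_inv (j : Fin n) : Rel n (fX j * fXinv j) 1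
  | inv_mul (j : Fin n) : Rel n (fXinv j * fX j) 1
  | comm (i j : Fin n) : Rel n (fX i * fX j) (fX j * fX i)
  | cross (i : Fin (n - 1)) : Rel n (fT i * fX (lo i) * fT i) (t • fX (hi i))
  | cross_far (i : Fin (n - 1)) (j : Fin n) (h₁ : j ≠ lo i) (h₂ : j ≠ hi i) :
      Rel n (fT i * fX j) (fX j * fT i)

/-- The affine Hecke algebra `H` of type `GL_n` over `ℤ[t, t⁻¹]`. -/
abbrev AHA (n : ℕ) : Type := RingQuot (Rel n)

/-- The quotient map from the free algebra onto `H`. -/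
def quo (n : ℕ) : FreeAlgebra R (Gen n) →ₐ[R] AHA n := RingQuot.mkAlgHom R (Rel n)

theorem quo_rel {n : ℕ} {a b : FreeAlgebra R (Gen n)} (h : Rel n a b) : quo n a = quo n b :=
  RingQuot.mkAlgHom_rel R h

theorem t_mul_inv : t * LaurentPolynomial.T (-1) = 1 := by
  rw [t, ← LaurentPolynomial.T_add]; simp

theorem T_sq {n : ℕ} (i : Fin (n - 1)) :
    quo n (fT i) * quo n (fT i) = (t - 1) • quo n (fT i) + t • 1 := by
  have h := quo_rel (Rel.quad i)
  simpa only [map_mul, map_add, map_smul, map_one] using h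

/-- The generator `T_i`, as a unit of `H`: its inverse is `t⁻¹ (T_i + 1 - t)`. -/
def TU {n : ℕ} (i : Fin (n - 1)) : (AHA n)ˣ where
  val := quo n (fT i)
  inv := (LaurentPolynomial.T (-1) : R) • (quo n (fT i) + (1 - t) • 1)
  val_inv := by
    rw [mul_smul_comm, mul_add, T_sq, mul_smul_comm, mul_one, add_right_comm, ← add_smul,
      show t - 1 + (1 - t) = (0 : R) by ring, zero_smul, zero_add, smul_smul, mul_comm,
      t_mul_inv, one_smul]
  inv_val := by
    rw [smul_mul_assoc, add_mul, T_sq, smul_mul_assoc, one_mul, add_right_comm, ← add_smul,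
      show t - 1 + (1 - t) = (0 : R) by ring, zero_smul, zero_add, smul_smul, mul_comm,
      t_mul_inv, one_smul]

/-- The generator `X_j`, as a unit of `H`. -/
def XU {n : ℕ} (j : Fin n) : (AHA n)ˣ where
  val := quo n (fX j)
  inv := quo n (fXinv j)
  val_inv := by rw [← map_mul, quo_rel (Rel.mul_inv j), map_one]
  inv_val := by rw [← map_mul, quo_rel (Rel.inv_mul j), map_one]

/-- `X^μ = X_1^{μ_1} ⋯ X_n^{μ_n}` for `μ ∈ ℤ^n`. -/
def Xpow {n : ℕ} (μ : Fin n → ℤ) : AHA n :=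
  (((List.ofFn fun j => XU j ^ μ j).prod : (AHA n)ˣ) : AHA n)

/-- `T_w = T_{i_1} ⋯ T_{i_k}` for a reduced expression `w = s_{i_1} ⋯ s_{i_k}`, as a unit of `H`.
By the braid relations it does not depend on the reduced expression. -/
def Tw {n : ℕ} (w : Equiv.Perm (Fin n)) : (AHA n)ˣ :=
  ((Classical.choose (exists_reduced w)).map TU).prod

/-- The finite Hecke symmetrizer `1_0 = ∑_{w ∈ S_n} T_w`. -/
def symmetrizer (n : ℕ) : AHA n := ∑ w : Equiv.Perm (Fin n), (Tw w : AHA n)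

/-- The parabolic symmetrizer `1_μ`, the sum of `T_w` over the stabilizer `S_{n,μ}` of `μ`. -/
def parSymmetrizer {n : ℕ} (μ : Fin n → ℤ) : AHA n :=
  ∑ w : Equiv.Perm (Fin n) with act w μ = μ, (Tw w : AHA n)

/-- The parabolic subalgebra `H_{n,μ}`, generated by the `T_w` with `w` in the stabilizer
`S_{n,μ}` of `μ`. -/
def parSubalgebra {n : ℕ} (μ : Fin n → ℤ) : Subalgebra R (AHA n) :=
  Algebra.adjoin R {h | ∃ w : Equiv.Perm (Fin n), act w μ = μ ∧ h = (Tw w : AHA n)}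

/-! ### Columns and tableaux -/

/-- `B(ϖ_ℓ)`: the columns of length `ℓ`. A strictly increasing sequence of `ℓ` letters is
identified with the set of its entries. -/
def colSet (n ℓ : ℕ) : Finset (Finset (Fin n)) := Finset.powersetCard ℓ Finset.univ

/-- For a column `C = (c_1 < ⋯ < c_ℓ)` with complement `(c'_{ℓ+1} < ⋯ < c'_n)`, the permutation
`u_C` that sends `1, …, ℓ` to `c_1, …, c_ℓ` and `ℓ + 1, …, n` to `c'_{ℓ+1}, …, c'_n`. -/
def colPerm {n : ℕ} (C : Finset (Fin n)) : Equiv.Perm (Fin n) :=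
  (finCongr (by rw [Finset.card_add_card_compl, Fintype.card_fin])).trans
    ((finSumFinEquiv (m := C.card) (n := Cᶜ.card)).symm.trans (finSumEquivOfFinset rfl rfl))

/-- The set `B(ϖ_{ℓ_r}) ⊗ ⋯ ⊗ B(ϖ_{ℓ_1})`, for the list `[ℓ_r, …, ℓ_1]`. Its element
`C_r ⊗ ⋯ ⊗ C_1` is the list `[C_r, …, C_1]` of the columns from left to right, and
`C ⊗ T` is `C :: T`. -/
def tensorB (n : ℕ) : List ℕ → Finset (List (Finset (Fin n)))
  | [] => {[]}
  | ℓ :: ls => (colSet n ℓ ×ˢ tensorB n ls).image fun p => p.1 :: p.2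

/-- In every row that meets both columns, the entry of `F` is at most the entry of `E`. -/
def RowLE {n : ℕ} (F E : Finset (Fin n)) : Prop :=
  ∀ (i : ℕ) (hF : i < F.card) (hE : i < E.card),
    F.orderEmbOfFin rfl ⟨i, hF⟩ ≤ E.orderEmbOfFin rfl ⟨i, hE⟩

/-- A column-strict filling, given by its columns from left to right, is semistandard if the
entries weakly increase along each row from left to right. -/
def IsSemistandard {n : ℕ} (T : List (Finset (Fin n))) : Prop := T.Pairwise RowLE

/-- The column lengths, from left to right, of the Young diagram with rows `λ_1 ≥ ⋯ ≥ λ_n`. -/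
def colLengths {n : ℕ} (lam : Fin n → ℕ) : List ℕ :=
  (List.range (Finset.univ.sup lam)).map fun j => (Finset.univ.filter fun i => j < lam i).card

open Classical in
/-- `B(λ)`: the semistandard Young tableaux of shape `λ` with entries in `{1, …, n}`, given by
their columns from left to right. -/
def ssyt {n : ℕ} (lam : Fin n → ℕ) : Finset (List (Finset (Fin n))) :=
  (tensorB n (colLengths lam)).filter IsSemistandard

/-- `X^T = ∏ X_i^{c_i}`, where `c_i` is the number of entries `i` in `T`. -/
def Xtab {n : ℕ} (T : List (Finset (Fin n))) : AHA n :=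
  Xpow fun i => ((T.countP fun C => decide (i ∈ C) : ℕ) : ℤ)

/-! ### The elements `Ψ_T` -/

/-- `h = ∑_{F ∈ B(ϖ_ℓ)} T_{u_F} h_F` with all `h_F` in `H_{n,ϖ_ℓ}`. -/
def IsParDecomp {n : ℕ} (ℓ : ℕ) (h : AHA n) (f : Finset (Fin n) → AHA n) : Prop :=
  (∀ F ∈ colSet n ℓ, f F ∈ parSubalgebra (fundWt n ℓ)) ∧
    h = ∑ F ∈ colSet n ℓ, (Tw (colPerm F) : AHA n) * f F

open Classical in
/-- The coefficients `h_F`, `F ∈ B(ϖ_ℓ)`, of the parabolic decomposition of `h`. The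
decomposition exists and is unique for `h` in the finite Hecke algebra. -/
def parCoeff {n : ℕ} (ℓ : ℕ) (h : AHA n) : Finset (Fin n) → AHA n :=
  if hex : ∃ f, IsParDecomp ℓ h f then Classical.choose hex else 0

/-- `t^{ℓ(u_C)} (T_{u_C⁻¹})⁻¹`. -/
def colFactor {n : ℕ} (C : Finset (Fin n)) : AHA n :=
  t ^ len (colPerm C) • (((Tw (colPerm C)⁻¹)⁻¹ : (AHA n)ˣ) : AHA n)

/-- The element `Ψ_T`, for a sequence `T` of columns from left to right, by recursion on the
number of columns. For the empty sequence it is `1_0`. -/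
def Psi {n : ℕ} : List (Finset (Fin n)) → AHA n
  | [] => symmetrizer n
  | [C] => colFactor C * parSymmetrizer (fundWt n C.card)
  | C :: D :: S => colFactor C * parCoeff C.card (Psi (D :: S)) C

end

end HeckeLift

open HeckeLift

namespace HeckeLift

/-! ### Length and inversions -/

section Length

variable {n : ℕ}

/-! The engine is one commutation identity: `Tw (colPerm C) * X^ϖ_ℓ = X^C * colFactor C`
(`Tw_colPerm_mul_Xpow`). Indeed `T_i X_i = t X_{i+1} T_i⁻¹`, so each letter of a reduced word of
`u_C` raises one index of the monomial and turns `T_i` into `t T_i⁻¹`. Since `X^ϖ_ℓ` also commutes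
with `H_{n,ϖ_ℓ}` (`mul_Xpow_fundWt`), multiplying a parabolic decomposition of `Ψ_T` by `X^ϖ_ℓ`
gives (b) term by term. Iterating (b) from `1_0` writes `1_0 X^λ` as a sum over all fillings whose
columns are those of the diagram of `λ`; by (a) only the semistandard ones remain, which is (c).

Part (a) is a statement about supports in the basis `T_w`. Because `T_i⁻¹` is a combination of `T_i`
and `1`, `colFactor D` involves only those `T_x` whose first `ℓ` values, taken as a set, lie below
`D` entry by entry (`colFactor_mem_TSpan`). Right multiplication by `H_{n,ϖ_ℓ}` does not change that
set, so `Ψ_{D⊗S}` has the same support property. If the coefficient at a column `C`, at least as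
long as `D`, is nonzero, then some such `x` has `C` as its set of first values; hence `C` contains a
set below `D`, and the rows increase weakly from `C` to `D`.

Reading off coefficients requires linear independence of the `T_w` inside the affine algebra, which
is given only by a presentation. It is obtained from a representation on functions on `S_n`, in
which the `X_j` act as Jucys–Murphy elements (`linearIndependent_Tw`). -/

theorem lo_lt_hi (i : Fin (n - 1)) : (lo i : Fin n) < hi i := by
  simp [lo, hi, Fin.lt_def]

theorem lo_ne_hi (i : Fin (n - 1)) : (lo i : Fin n) ≠ hi i := (lo_lt_hi i).ne

@[simp] theorem simple_lo (i : Fin (n - 1)) : (simple i : Equiv.Perm (Fin n)) (lo i) = hi i := by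
  simp [simple]

@[simp] theorem simple_hi (i : Fin (n - 1)) : (simple i : Equiv.Perm (Fin n)) (hi i) = lo i := by
  simp [simple]

theorem simple_of_ne {i : Fin (n - 1)} {a : Fin n} (h₁ : a ≠ lo i) (h₂ : a ≠ hi i) :
    simple i a = a := Equiv.swap_apply_of_ne_of_ne h₁ h₂

@[simp] theorem simple_mul_self (i : Fin (n - 1)) :
    (simple i : Equiv.Perm (Fin n)) * simple i = 1 := Equiv.swap_mul_self _ _

@[simp] theorem simple_inv (i : Fin (n - 1)) :
    (simple i : Equiv.Perm (Fin n))⁻¹ = simple i := Equiv.swap_inv _ _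

@[simp] theorem simple_simple (i : Fin (n - 1)) (a : Fin n) : simple i (simple i a) = a :=
  Equiv.swap_apply_self _ _ _

@[simp] theorem simple_mul_cancel (i : Fin (n - 1)) (w : Equiv.Perm (Fin n)) :
    simple i * (simple i * w) = w := by rw [← mul_assoc, simple_mul_self, one_mul]

theorem simple_lt_simple {i : Fin (n - 1)} {a b : Fin n} (h : a < b)
    (hab : a ≠ lo i ∨ b ≠ hi i) : simple i a < simple i b := by
  simp only [simple, Equiv.swap_apply_def]
  simp only [lo, hi, Fin.ext_iff, Fin.lt_def, ne_eq] at *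
  split_ifs <;> (try simp only) <;> omega

/-- The index `i` is a left ascent of `w`. -/
def IsAsc (i : Fin (n - 1)) (w : Equiv.Perm (Fin n)) : Prop := w⁻¹ (lo i) < w⁻¹ (hi i)

theorem not_isAsc {i : Fin (n - 1)} {w : Equiv.Perm (Fin n)} :
    ¬ IsAsc i w ↔ w⁻¹ (hi i) < w⁻¹ (lo i) := by
  rw [IsAsc, not_lt]
  exact ⟨fun h => lt_of_le_of_ne h fun e => lo_ne_hi i (w⁻¹.injective e).symm, le_of_lt⟩

theorem isAsc_simple_mul {i : Fin (n - 1)} {w : Equiv.Perm (Fin n)} :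
    IsAsc i (simple i * w) ↔ ¬ IsAsc i w := by
  rw [not_isAsc, IsAsc]
  simp [mul_inv_rev]

/-- The inversions of `w⁻¹`. -/
def invSet (w : Equiv.Perm (Fin n)) : Finset (Fin n × Fin n) :=
  {p | p.1 < p.2 ∧ w⁻¹ p.2 < w⁻¹ p.1}

/-- The transposition `s_i` preserves the order of every pair of letters except `(i, i + 1)`.
Applying it to both letters therefore carries the old inversions to the new ones, and the pair `(i,
i + 1)` itself is the only addition. -/
theorem card_invSet_simple_mul {i : Fin (n - 1)} {w : Equiv.Perm (Fin n)} (h : IsAsc i w) :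
    (invSet (simple i * w)).card = (invSet w).card + 1 := by
  have key : invSet (simple i * w) = insert (lo i, hi i)
      ((invSet w).map ((Equiv.prodCongr (simple i) (simple i)).toEmbedding)) := by
    ext ⟨a, b⟩
    simp only [invSet, Finset.mem_filter, Finset.mem_univ, true_and, Finset.mem_insert,
      Finset.mem_map_equiv, Prod.mk.injEq, mul_inv_rev, simple_inv, Equiv.Perm.mul_apply]
    have hs : (simple i : Equiv.Perm (Fin n)).symm = simple i := simple_inv i
    simp only [Equiv.prodCongr_symm, hs, Equiv.prodCongr_apply, Prod.map_apply]
    constructor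
    · rintro ⟨hab, hw⟩
      by_cases he : a = lo i ∧ b = hi i
      · exact Or.inl he
      · exact Or.inr ⟨simple_lt_simple hab (not_and_or.1 he), hw⟩
    · rintro (⟨rfl, rfl⟩ | ⟨hab, hw⟩)
      · exact ⟨lo_lt_hi i, by rwa [simple_hi, simple_lo]⟩
      · refine ⟨?_, hw⟩
        have := simple_lt_simple (i := i) hab ?_
        · simpa using this
        · by_contra hc
          push Not at hc
          rw [hc.1, hc.2] at hw
          exact lt_asymm h hw
  rw [key, Finset.card_insert_of_notMem, Finset.card_map]
  intro hm
  have hs : (simple i : Equiv.Perm (Fin n)).symm = simple i := simple_inv i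
  simp only [Finset.mem_map_equiv, Equiv.prodCongr_symm, hs, Equiv.prodCongr_apply,
    Prod.map_apply, invSet, Finset.mem_filter, simple_lo, simple_hi] at hm
  exact lt_asymm hm.2.1 (lo_lt_hi i)

theorem card_invSet_simple_mul_of_not {i : Fin (n - 1)} {w : Equiv.Perm (Fin n)}
    (h : ¬ IsAsc i w) : (invSet (simple i * w)).card + 1 = (invSet w).card := by
  have := card_invSet_simple_mul (isAsc_simple_mul.2 h)
  rw [simple_mul_cancel] at this
  exact this.symm

theorem eq_one_of_forall_isAsc {w : Equiv.Perm (Fin n)} (h : ∀ i, IsAsc i w) : w = 1 := by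
  have hm : StrictMono (w⁻¹ : Equiv.Perm (Fin n)) := by
    cases n with
    | zero => exact fun a => a.elim0
    | succ m => exact Fin.strictMono_iff_lt_succ.2 fun i => h i
  have : (w⁻¹ : Equiv.Perm (Fin n)) = 1 := by
    ext a
    have := congrArg (fun f => (f a : Fin n)) (Subsingleton.elim
      (hm.orderIsoOfSurjective _ (w⁻¹).surjective) (OrderIso.refl _))
    simpa using congrArg Fin.val this
  simpa using this

theorem wordProd_cons (i : Fin (n - 1)) (a : List (Fin (n - 1))) :
    (wordProd (i :: a) : Equiv.Perm (Fin n)) = simple i * wordProd a := by simp [wordProd]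

theorem wordProd_append (a b : List (Fin (n - 1))) :
    (wordProd (a ++ b) : Equiv.Perm (Fin n)) = wordProd a * wordProd b := by simp [wordProd]

theorem card_invSet_wordProd_le (a : List (Fin (n - 1))) :
    (invSet (wordProd a : Equiv.Perm (Fin n))).card ≤ a.length := by
  induction a with
  | nil => simp [wordProd, invSet]; intro a b h; exact h.le
  | cons i a ih =>
    rw [wordProd_cons, List.length_cons]
    by_cases h : IsAsc i (wordProd a : Equiv.Perm (Fin n))
    · rw [card_invSet_simple_mul h]; omega
    · have := card_invSet_simple_mul_of_not h; omega

theorem exists_word_card_invSet (w : Equiv.Perm (Fin n)) :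
    ∃ a : List (Fin (n - 1)), wordProd a = w ∧ a.length = (invSet w).card := by
  induction hk : (invSet w).card generalizing w with
  | zero =>
    refine ⟨[], ?_, rfl⟩
    rw [eq_one_of_forall_isAsc (w := w) fun i => ?_]
    · rfl
    · by_contra h
      have := card_invSet_simple_mul_of_not h
      omega
  | succ k ih =>
    have : ∃ i, ¬ IsAsc i w := by
      by_contra! h
      rw [eq_one_of_forall_isAsc h] at hk
      have := card_invSet_wordProd_le (n := n) []
      simp only [wordProd, List.map_nil, List.prod_nil, List.length_nil] at this
      omega
    obtain ⟨i, hi⟩ := this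
    have := card_invSet_simple_mul_of_not hi
    obtain ⟨a, ha, hl⟩ := ih (simple i * w) (by omega)
    exact ⟨i :: a, by rw [wordProd_cons, ha, simple_mul_cancel], by simp [hl]⟩

theorem len_eq_card_invSet (w : Equiv.Perm (Fin n)) : len w = (invSet w).card := by
  apply le_antisymm
  · exact Nat.sInf_le (exists_word_card_invSet w)
  · obtain ⟨a, rfl, hl⟩ := exists_reduced w
    rw [← hl]
    exact card_invSet_wordProd_le a

theorem len_simple_mul {i : Fin (n - 1)} {w : Equiv.Perm (Fin n)} (h : IsAsc i w) :
    len (simple i * w) = len w + 1 := by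
  rw [len_eq_card_invSet, len_eq_card_invSet, card_invSet_simple_mul h]

theorem len_simple_mul_of_not {i : Fin (n - 1)} {w : Equiv.Perm (Fin n)} (h : ¬ IsAsc i w) :
    len (simple i * w) + 1 = len w := by
  rw [len_eq_card_invSet, len_eq_card_invSet, card_invSet_simple_mul_of_not h]

@[simp] theorem len_one : len (1 : Equiv.Perm (Fin n)) = 0 :=
  Nat.eq_zero_of_le_zero (Nat.sInf_le ⟨[], rfl, rfl⟩)

theorem wordProd_reverse (a : List (Fin (n - 1))) :
    (wordProd a.reverse : Equiv.Perm (Fin n)) = (wordProd a)⁻¹ := by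
  induction a with
  | nil => simp [wordProd]
  | cons i a ih =>
    rw [List.reverse_cons, wordProd_append, ih, wordProd_cons i a, mul_inv_rev, simple_inv]
    simp [wordProd]

theorem len_wordProd_le (a : List (Fin (n - 1))) :
    len (wordProd a : Equiv.Perm (Fin n)) ≤ a.length := Nat.sInf_le ⟨a, rfl, rfl⟩

theorem len_inv (w : Equiv.Perm (Fin n)) : len w⁻¹ = len w := by
  have key : ∀ v : Equiv.Perm (Fin n), len v⁻¹ ≤ len v := fun v => by
    obtain ⟨a, rfl, hl⟩ := exists_reduced v
    rw [← hl, ← wordProd_reverse, ← a.length_reverse]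
    exact len_wordProd_le _
  exact le_antisymm (key w) (by simpa using key w⁻¹)

theorem isReduced_cons {i : Fin (n - 1)} {a : List (Fin (n - 1))} {w : Equiv.Perm (Fin n)}
    (h : IsReduced w (i :: a)) : ¬ IsAsc i w ∧ IsReduced (simple i * w) a := by
  obtain ⟨hw, hl⟩ := h
  have ha : wordProd a = simple i * w := by rw [← hw, wordProd_cons, simple_mul_cancel]
  have h1 := len_wordProd_le (n := n) a
  rw [ha] at h1
  rw [List.length_cons] at hl
  have hd : ¬ IsAsc i w := fun h => by
    have := len_simple_mul h; omega
  have := len_simple_mul_of_not hd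
  exact ⟨hd, ha, by omega⟩

theorem IsReduced.cons {i : Fin (n - 1)} {a : List (Fin (n - 1))} {w : Equiv.Perm (Fin n)}
    (h : IsReduced (simple i * w) a) (hi : ¬ IsAsc i w) : IsReduced w (i :: a) := by
  refine ⟨by rw [wordProd_cons, h.1, simple_mul_cancel], ?_⟩
  rw [List.length_cons, h.2, len_simple_mul_of_not hi]

theorem hi_eq_lo {i j : Fin (n - 1)} (h : (j : ℕ) = i + 1) : (hi i : Fin n) = lo j := by
  simp [hi, lo, h]

theorem simple_lo_of_succ {i j : Fin (n - 1)} (h : (j : ℕ) = i + 1) :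
    (simple j : Equiv.Perm (Fin n)) (lo i) = lo i :=
  simple_of_ne (by simp [lo, Fin.ext_iff, h]) (by simp only [lo, hi, ne_eq, Fin.ext_iff]; omega)

theorem simple_hi_of_succ {i j : Fin (n - 1)} (h : (j : ℕ) = i + 1) :
    (simple i : Equiv.Perm (Fin n)) (hi j) = hi j :=
  simple_of_ne (by simp only [lo, hi, ne_eq, Fin.ext_iff]; omega)
    (by simp only [hi, ne_eq, Fin.ext_iff]; omega)

theorem simple_mul_simple_mul_simple (i j : Fin (n - 1)) :
    (simple i : Equiv.Perm (Fin n)) * simple j * simple i =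
      Equiv.swap (simple i (lo j)) (simple i (hi j)) := by
  rw [Equiv.swap_apply_apply, simple_inv]
  rfl

theorem simple_comm {i j : Fin (n - 1)} (h : (i : ℕ) + 1 < j ∨ (j : ℕ) + 1 < i) :
    (simple i : Equiv.Perm (Fin n)) * simple j = simple j * simple i := by
  have := simple_mul_simple_mul_simple (n := n) i j
  rw [simple_of_ne, simple_of_ne] at this
  · rw [← mul_left_inj (simple i), this, mul_assoc, simple_mul_self, mul_one]
    rfl
  all_goals simp only [lo, hi, ne_eq, Fin.ext_iff]; omega

theorem simple_braid {i j : Fin (n - 1)} (h : (j : ℕ) = i + 1) :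
    (simple i : Equiv.Perm (Fin n)) * simple j * simple i = simple j * simple i * simple j := by
  rw [simple_mul_simple_mul_simple, simple_mul_simple_mul_simple, simple_lo_of_succ h,
    simple_hi_of_succ h, ← hi_eq_lo h, simple_hi, hi_eq_lo h, simple_lo]

theorem isAsc_simple_mul_of_far {i j : Fin (n - 1)} (h : (i : ℕ) + 1 < j ∨ (j : ℕ) + 1 < i)
    (w : Equiv.Perm (Fin n)) : IsAsc i (simple j * w) ↔ IsAsc i w := by
  rw [IsAsc, IsAsc, mul_inv_rev, simple_inv, Equiv.Perm.mul_apply, Equiv.Perm.mul_apply,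
    simple_of_ne, simple_of_ne] <;> simp only [lo, hi, ne_eq, Fin.ext_iff] <;> omega

end Length

/-! ### Ascents after multiplication by adjacent simple transpositions -/

section BraidAscents

variable {n : ℕ} {i j : Fin (n - 1)}

theorem isAsc_succ (h : (j : ℕ) = i + 1) (w : Equiv.Perm (Fin n)) :
    IsAsc j w ↔ w⁻¹ (hi i) < w⁻¹ (hi j) := by rw [IsAsc, hi_eq_lo h]

theorem isAsc_succ_simple_mul (h : (j : ℕ) = i + 1) (w : Equiv.Perm (Fin n)) :
    IsAsc j (simple i * w) ↔ w⁻¹ (lo i) < w⁻¹ (hi j) := by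
  rw [IsAsc, mul_inv_rev, simple_inv, Equiv.Perm.mul_apply, Equiv.Perm.mul_apply, ← hi_eq_lo h,
    simple_hi, simple_hi_of_succ h]

theorem isAsc_simple_succ_mul (h : (j : ℕ) = i + 1) (w : Equiv.Perm (Fin n)) :
    IsAsc i (simple j * w) ↔ w⁻¹ (lo i) < w⁻¹ (hi j) := by
  rw [IsAsc, mul_inv_rev, simple_inv, Equiv.Perm.mul_apply, Equiv.Perm.mul_apply, hi_eq_lo h,
    simple_lo, simple_lo_of_succ h]

theorem isAsc_simple_succ_mul_simple_mul (h : (j : ℕ) = i + 1) (w : Equiv.Perm (Fin n)) :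
    IsAsc i (simple j * (simple i * w)) ↔ IsAsc j w := by
  rw [isAsc_simple_succ_mul h, isAsc_succ h, mul_inv_rev, simple_inv, Equiv.Perm.mul_apply,
    Equiv.Perm.mul_apply, simple_lo, simple_hi_of_succ h]

theorem isAsc_succ_simple_mul_simple_succ_mul (h : (j : ℕ) = i + 1) (w : Equiv.Perm (Fin n)) :
   
    IsAsc j (simple i * (simple j * w)) ↔ IsAsc i w := by
  rw [isAsc_succ_simple_mul h, IsAsc, mul_inv_rev, simple_inv, Equiv.Perm.mul_apply,
    Equiv.Perm.mul_apply, simple_hi, simple_lo_of_succ h, hi_eq_lo h]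

end BraidAscents

/-! ### Matsumoto's theorem and the multiplication rules -/

section Matsumoto

variable {n : ℕ}

theorem TU_comm {i j : Fin (n - 1)} (h : (i : ℕ) + 1 < j ∨ (j : ℕ) + 1 < i) :
    (TU i : (AHA n)ˣ) * TU j = TU j * TU i :=
  Units.ext (by simpa only [map_mul] using! quo_rel (Rel.far i j h))

theorem TU_braid {i j : Fin (n - 1)} (h : (j : ℕ) = i + 1) :
    (TU i : (AHA n)ˣ) * TU j * TU i = TU j * TU i * TU j :=
  Units.ext (by simpa only [map_mul] using! quo_rel (Rel.braid i j h))

/-- The product of the `T_i` along a word. -/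
noncomputable def Tword (a : List (Fin (n - 1))) : (AHA n)ˣ := (a.map TU).prod

theorem Tword_cons (i : Fin (n - 1)) (a : List (Fin (n - 1))) :
    (Tword (i :: a) : (AHA n)ˣ) = TU i * Tword a := by simp [Tword]

/-- Matsumoto's theorem for the symmetric group. -/
theorem Tword_eq_of_isReduced {w : Equiv.Perm (Fin n)} {a b : List (Fin (n - 1))}
    (ha : IsReduced w a) (hb : IsReduced w b) : (Tword a : (AHA n)ˣ) = Tword b := by
  induction hk : len w using Nat.strong_induction_on generalizing w a b with
  | _ k ih =>
  have far_case : ∀ {i j : Fin (n - 1)} {a b : List (Fin (n - 1))},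
      ((i : ℕ) + 1 < j ∨ (j : ℕ) + 1 < i) → IsReduced w (i :: a) →
      IsReduced w (j :: b) → (Tword (i :: a) : (AHA n)ˣ) = Tword (j :: b) := by
    intro i j a b h ha hb
    obtain ⟨hi, ha⟩ := isReduced_cons ha
    obtain ⟨hj, hb⟩ := isReduced_cons hb
    -- Both `i` and `j` are descents and `s_i`, `s_j` commute, so `w` has the reduced words `i j c`
    -- and `j i c`. By induction each given word agrees with the one sharing its first letter.
    obtain ⟨c, hc⟩ := exists_reduced (simple j * (simple i * w))
    have h1 := len_simple_mul_of_not hi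
    have h2 := len_simple_mul_of_not hj
    have e1 := ih _ (by omega) ha
      (hc.cons (by rwa [isAsc_simple_mul_of_far h.symm])) rfl
    rw [← mul_assoc, ← simple_comm h, mul_assoc] at hc
    have e2 := ih _ (by omega) hb (hc.cons (by rwa [isAsc_simple_mul_of_far h])) rfl
    rw [Tword_cons, Tword_cons, e1, e2, Tword_cons, Tword_cons, ← mul_assoc, ← mul_assoc,
      TU_comm h]
  have braid_case : ∀ {i j : Fin (n - 1)} {a b : List (Fin (n - 1))},
      ((j : ℕ) = i + 1) → IsReduced w (i :: a) →
      IsReduced w (j :: b) → (Tword (i :: a) : (AHA n)ˣ) = Tword (j :: b) := by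
    intro i j a b h ha hb
    obtain ⟨hi, ha⟩ := isReduced_cons ha
    obtain ⟨hj, hb⟩ := isReduced_cons hb
    -- Two adjacent descents let the whole product `s_i s_j s_i` be split off: `i j i c` and `j i j
    -- c` are both reduced words of `w`, related by one braid relation.
    obtain ⟨c, hc⟩ := exists_reduced (simple i * (simple j * (simple i * w)))
    have h1 := len_simple_mul_of_not hi
    have h2 := len_simple_mul_of_not hj
    have hlt := not_isAsc.1 hj
    rw [← hi_eq_lo h] at hlt
    replace hlt := hlt.trans (not_isAsc.1 hi)
    have hi' := mt (isAsc_simple_succ_mul h w).1 hlt.not_gt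
    have hj' := mt (isAsc_succ_simple_mul h w).1 hlt.not_gt
    have e1 := ih _ (by omega) ha
      ((hc.cons (by rwa [isAsc_simple_succ_mul_simple_mul h])).cons hj') rfl
    rw [← mul_assoc, ← mul_assoc, simple_braid h, mul_assoc, mul_assoc] at hc
    have e2 := ih _ (by omega) hb
      ((hc.cons (by rwa [isAsc_succ_simple_mul_simple_succ_mul h])).cons hi') rfl
    rw [Tword_cons, Tword_cons, e1, e2]
    simp only [Tword_cons]
    rw [← mul_assoc, ← mul_assoc, TU_braid h]
    simp only [mul_assoc]
  match a, b, ha, hb with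
  | [], [], _, _ => rfl
  | [], _ :: _, ha, hb => have := ha.2.trans hb.2.symm; simp at this
  | _ :: _, [], ha, hb => have := ha.2.trans hb.2.symm; simp at this
  | i :: a, j :: b, ha, hb =>
    rcases lt_trichotomy (i : ℕ) j with h | h | h
    · by_cases h' : (j : ℕ) = i + 1
      · exact braid_case h' ha hb
      · exact far_case (by omega) ha hb
    · obtain rfl := Fin.ext h
      rw [Tword_cons, Tword_cons, ih _ ?_ (isReduced_cons ha).2 (isReduced_cons hb).2 rfl]
      have := len_simple_mul_of_not (isReduced_cons ha).1
      omega
    · by_cases h' : (i : ℕ) = j + 1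
      · exact (braid_case h' hb ha).symm
      · exact far_case (by omega) ha hb

theorem Tw_eq_Tword {w : Equiv.Perm (Fin n)} {a : List (Fin (n - 1))} (ha : IsReduced w a) :
    Tw w = Tword a :=
  Tword_eq_of_isReduced (Classical.choose_spec (exists_reduced w)) ha

@[simp] theorem Tw_one : Tw (1 : Equiv.Perm (Fin n)) = 1 :=
  Tw_eq_Tword (a := []) ⟨rfl, by simp⟩

theorem Tw_of_not_isAsc {i : Fin (n - 1)} {w : Equiv.Perm (Fin n)} (h : ¬ IsAsc i w) :
    Tw w = TU i * Tw (simple i * w) := by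
  obtain ⟨a, ha⟩ := exists_reduced (simple i * w)
  rw [Tw_eq_Tword ha, Tw_eq_Tword (ha.cons h), Tword_cons]

theorem Tw_simple_mul {i : Fin (n - 1)} {w : Equiv.Perm (Fin n)} (h : IsAsc i w) :
    Tw (simple i * w) = TU i * Tw w := by
  rw [Tw_of_not_isAsc (i := i) (w := simple i * w) (by rwa [isAsc_simple_mul, not_not]),
    simple_mul_cancel]

theorem Tw_mul_simple {i : Fin (n - 1)} {w : Equiv.Perm (Fin n)} (h : IsAsc i w⁻¹) :
    Tw (w * simple i) = Tw w * TU i := by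
  obtain ⟨a, ha⟩ := exists_reduced w
  have hr : IsReduced (w * simple i) (a ++ [i]) := by
    refine ⟨by rw [wordProd_append, ha.1]; simp [wordProd], ?_⟩
    rw [← len_inv, mul_inv_rev, simple_inv, len_simple_mul h, len_inv, ← ha.2]
    simp
  rw [Tw_eq_Tword ha, Tw_eq_Tword hr]
  simp [Tword]

theorem TU_sq (i : Fin (n - 1)) :
    (TU i : AHA n) * TU i = (t - 1) • (TU i : AHA n) + t • 1 := T_sq i

theorem TU_mul_Tw_of_isAsc {i : Fin (n - 1)} {w : Equiv.Perm (Fin n)} (h : IsAsc i w) :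
    (TU i : AHA n) * Tw w = Tw (simple i * w) := by
  rw [Tw_simple_mul h, Units.val_mul]

theorem TU_mul_Tw_of_not_isAsc {i : Fin (n - 1)} {w : Equiv.Perm (Fin n)} (h : ¬ IsAsc i w) :
    (TU i : AHA n) * Tw w = (t - 1) • (Tw w : AHA n) + t • (Tw (simple i * w) : AHA n) := by
  rw [Tw_of_not_isAsc h, Units.val_mul, ← mul_assoc, TU_sq, add_mul, smul_mul_assoc,
    smul_mul_assoc, one_mul]

theorem Tw_mul_TU_of_isAsc {i : Fin (n - 1)} {w : Equiv.Perm (Fin n)} (h : IsAsc i w⁻¹) :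
    (Tw w : AHA n) * TU i = Tw (w * simple i) := by
  rw [Tw_mul_simple h, Units.val_mul]

theorem Tw_mul_TU_of_not_isAsc {i : Fin (n - 1)} {w : Equiv.Perm (Fin n)} (h : ¬ IsAsc i w⁻¹) :
    (Tw w : AHA n) * TU i = (t - 1) • (Tw w : AHA n) + t • (Tw (w * simple i) : AHA n) := by
  have e : (Tw w : AHA n) = Tw (w * simple i) * TU i := by
    have := Tw_mul_simple (i := i) (w := w * simple i)
      (by rwa [mul_inv_rev, simple_inv, isAsc_simple_mul])
    rw [mul_assoc, simple_mul_self, mul_one] at this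
    rw [this, Units.val_mul]
  rw [e, mul_assoc, TU_sq, mul_add, mul_smul_comm, mul_smul_comm, mul_one]

end Matsumoto

/-! ### Spans of the elements `T_w` -/

section Span

variable {n : ℕ}

/-- The span of the `T_w` with `w ∈ A`. -/
noncomputable def TSpan (A : Set (Equiv.Perm (Fin n))) : Submodule R (AHA n) :=
  Submodule.span R ((fun w => (Tw w : AHA n)) '' A)

theorem Tw_mem_TSpan {A : Set (Equiv.Perm (Fin n))} {w : Equiv.Perm (Fin n)} (h : w ∈ A) :
    (Tw w : AHA n) ∈ TSpan A := Submodule.subset_span ⟨w, h, rfl⟩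

theorem TSpan_mono {A B : Set (Equiv.Perm (Fin n))} (h : A ⊆ B) : TSpan A ≤ TSpan B :=
  Submodule.span_mono (Set.image_mono h)

theorem TU_mul_mem_TSpan {A B : Set (Equiv.Perm (Fin n))} {i : Fin (n - 1)}
    (hAB : A ⊆ B) (hs : ∀ x ∈ A, simple i * x ∈ B) {h : AHA n} (hh : h ∈ TSpan A) :
    (TU i : AHA n) * h ∈ TSpan B := by
  induction hh using Submodule.span_induction with
  | mem x hx =>
    obtain ⟨w, hw, rfl⟩ := hx
    by_cases hi : IsAsc i w
    · simp only [TU_mul_Tw_of_isAsc hi]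
      exact Tw_mem_TSpan (hs w hw)
    · simp only [TU_mul_Tw_of_not_isAsc hi]
      exact add_mem (Submodule.smul_mem _ _ (Tw_mem_TSpan (hAB hw)))
        (Submodule.smul_mem _ _ (Tw_mem_TSpan (hs w hw)))
  | zero => rw [mul_zero]; exact zero_mem _
  | add x y _ _ hx hy => rw [mul_add]; exact add_mem hx hy
  | smul c x _ hx => rw [mul_smul_comm]; exact Submodule.smul_mem _ _ hx

theorem TU_inv (i : Fin (n - 1)) : ((TU i)⁻¹ : (AHA n)ˣ).val =
    (LaurentPolynomial.T (-1) : R) • ((TU i : AHA n) + (1 - t) • 1) := rfl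

/-- The inverse of `T_i` is a combination of `T_i` and `1`, so it enlarges supports no more than
`T_i` does. -/
theorem TU_inv_mul_mem_TSpan {A B : Set (Equiv.Perm (Fin n))} {i : Fin (n - 1)}
    (hAB : A ⊆ B) (hs : ∀ x ∈ A, simple i * x ∈ B) {h : AHA n} (hh : h ∈ TSpan A) :
    ((TU i)⁻¹ : (AHA n)ˣ).val * h ∈ TSpan B := by
  rw [TU_inv, smul_mul_assoc, add_mul, smul_mul_assoc, one_mul]
  exact Submodule.smul_mem _ _ (add_mem (TU_mul_mem_TSpan hAB hs hh)
    (Submodule.smul_mem _ _ (TSpan_mono hAB hh)))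

theorem mul_TU_mem_TSpan {A : Set (Equiv.Perm (Fin n))} {i : Fin (n - 1)}
    (hs : ∀ x ∈ A, x * simple i ∈ A) {h : AHA n} (hh : h ∈ TSpan A) :
    h * (TU i : AHA n) ∈ TSpan A := by
  induction hh using Submodule.span_induction with
  | mem x hx =>
    obtain ⟨w, hw, rfl⟩ := hx
    by_cases hi : IsAsc i w⁻¹
    · simp only [Tw_mul_TU_of_isAsc hi]
      exact Tw_mem_TSpan (hs w hw)
    · simp only [Tw_mul_TU_of_not_isAsc hi]
      exact add_mem (Submodule.smul_mem _ _ (Tw_mem_TSpan hw))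
        (Submodule.smul_mem _ _ (Tw_mem_TSpan (hs w hw)))
  | zero => rw [zero_mul]; exact zero_mem _
  | add x y _ _ hx hy => rw [add_mul]; exact add_mem hx hy
  | smul c x _ hx => rw [smul_mul_assoc]; exact Submodule.smul_mem _ _ hx

/-- The stabilizer of `ϖ_ℓ`. -/
def stab (n ℓ : ℕ) : Set (Equiv.Perm (Fin n)) := {w | act w (fundWt n ℓ) = fundWt n ℓ}

theorem mem_stab_iff {ℓ : ℕ} {w : Equiv.Perm (Fin n)} :
    w ∈ stab n ℓ ↔ ∀ k : Fin n, (w k : ℕ) < ℓ ↔ (k : ℕ) < ℓ := by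
  have e : ∀ a b : Fin n, fundWt n ℓ a = fundWt n ℓ b ↔ ((b : ℕ) < ℓ ↔ (a : ℕ) < ℓ) := by
    intro a b
    simp only [fundWt]
    split_ifs <;> simp <;> omega
  rw [stab, Set.mem_ofPred_eq, funext_iff]
  simp only [act, e]
  exact ⟨fun h k => by simpa using h (w k), fun h k => by simpa using h (w⁻¹ k)⟩

theorem one_mem_stab (n ℓ : ℕ) : 1 ∈ stab n ℓ := mem_stab_iff.2 fun _ => Iff.rfl

theorem mul_mem_stab {ℓ : ℕ} {v w : Equiv.Perm (Fin n)} (hv : v ∈ stab n ℓ)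
    (hw : w ∈ stab n ℓ) : v * w ∈ stab n ℓ :=
  mem_stab_iff.2 fun k => (mem_stab_iff.1 hv _).trans (mem_stab_iff.1 hw k)

theorem inv_lt_iff_of_mem_stab {ℓ : ℕ} {w : Equiv.Perm (Fin n)} (hw : w ∈ stab n ℓ) (k : Fin n) :
    (w⁻¹ k : ℕ) < ℓ ↔ (k : ℕ) < ℓ := by simpa using (mem_stab_iff.1 hw (w⁻¹ k)).symm

theorem simple_mem_stab {ℓ : ℕ} {i : Fin (n - 1)} (h : (i : ℕ) + 1 ≠ ℓ) :
    simple i ∈ stab n ℓ := by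
  refine mem_stab_iff.2 fun k => ?_
  simp only [simple, Equiv.swap_apply_def, lo, hi, Fin.ext_iff]
  split_ifs <;> simp_all <;> omega

/-- A stabilizer element keeps the first `ℓ` positions apart from the rest, so it cannot reverse the
two letters on either side of the cut. With letters numbered from `0`, these are the letters `ℓ - 1`
and `ℓ`. -/
theorem ne_of_not_isAsc_of_mem_stab {ℓ : ℕ} {i : Fin (n - 1)} {w : Equiv.Perm (Fin n)}
    (hw : w ∈ stab n ℓ) (hi : ¬ IsAsc i w) : (i : ℕ) + 1 ≠ ℓ := by
  intro h
  have h1 := (inv_lt_iff_of_mem_stab hw (lo i)).2 (by simp only [lo]; omega)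
  have h2 := mt (inv_lt_iff_of_mem_stab hw (HeckeLift.hi i)).1 (by simp only [HeckeLift.hi]; omega)
  have := Fin.lt_def.1 (not_isAsc.1 hi)
  omega

/-- Induction on the elements of the stabilizer of `ϖ_ℓ`, along a reduced word. -/
theorem stab_induction {ℓ : ℕ} {p : Equiv.Perm (Fin n) → Prop} (one : p 1)
    (step : ∀ (i : Fin (n - 1)) (w : Equiv.Perm (Fin n)), (i : ℕ) + 1 ≠ ℓ → w ∈ stab n ℓ → IsAsc i w →
      p w → p (simple i * w))
    {w : Equiv.Perm (Fin n)} (hw : w ∈ stab n ℓ) : p w := by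
  induction hk : len w generalizing w with
  | zero =>
    rwa [eq_one_of_forall_isAsc (w := w) fun i => ?_]
    by_contra h
    have := len_simple_mul_of_not h
    omega
  | succ k ih =>
    have : ∃ i, ¬ IsAsc i w := by
      by_contra! h
      rw [eq_one_of_forall_isAsc h] at hk
      simp at hk
    obtain ⟨i, hi⟩ := this
    have hne := ne_of_not_isAsc_of_mem_stab hw hi
    have hs := mul_mem_stab (simple_mem_stab hne) hw
    have := len_simple_mul_of_not hi
    rw [← simple_mul_cancel i w]
    exact step i _ hne hs (isAsc_simple_mul.2 hi) (ih hs (by omega))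

/-- Along reduced words, the generators of the parabolic subalgebra are products of `T_i` with `s_i`
in the stabilizer. Supports that are unions of left cosets of the stabilizer are thus preserved. -/
theorem mul_mem_TSpan {ℓ : ℕ} {A : Set (Equiv.Perm (Fin n))}
    (hA : ∀ x ∈ A, ∀ v ∈ stab n ℓ, x * v ∈ A) {h : AHA n} (hh : h ∈ TSpan A)
    {g : AHA n} (hg : g ∈ parSubalgebra (fundWt n ℓ)) : h * g ∈ TSpan A := by
  induction hg using Algebra.adjoin_induction generalizing h with
  | mem x hx =>
    obtain ⟨w, hw, rfl⟩ := hx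
    refine stab_induction (ℓ := ℓ) (p := fun w => ∀ h ∈ TSpan A, h * (Tw w : AHA n) ∈ TSpan A)
      ?_ ?_ hw h hh
    · intro h hh
      simpa using hh
    · intro i w hi _ ha ih h hh
      rw [Tw_simple_mul ha, Units.val_mul, ← mul_assoc]
      exact ih _ (mul_TU_mem_TSpan (fun x hx => hA x hx _ (simple_mem_stab hi)) hh)
  | algebraMap r =>
    rw [← Algebra.commutes, ← Algebra.smul_def]
    exact Submodule.smul_mem _ _ hh
  | add x y _ _ hx hy => rw [mul_add]; exact add_mem (hx hh) (hy hh)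
  | mul x y _ _ hx hy => rw [← mul_assoc]; exact hy (hx hh)

theorem Tw_mem_parSubalgebra {ℓ : ℕ} {w : Equiv.Perm (Fin n)} (hw : w ∈ stab n ℓ) :
    (Tw w : AHA n) ∈ parSubalgebra (fundWt n ℓ) := Algebra.subset_adjoin ⟨w, hw, rfl⟩

end Span

/-! ### Column permutations -/

section Columns

variable {n : ℕ}

/-- `u` sends the first `ℓ` letters to `C`, and it is increasing on these letters and on the
other ones. -/
structure IsColPerm (ℓ : ℕ) (C : Finset (Fin n)) (u : Equiv.Perm (Fin n)) : Prop where
  mem_iff : ∀ k, u k ∈ C ↔ (k : ℕ) < ℓ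
  lt : ∀ a b : Fin n, a < b → ((a : ℕ) < ℓ ↔ (b : ℕ) < ℓ) → u a < u b

theorem IsColPerm.inv_lt_iff {ℓ : ℕ} {C : Finset (Fin n)} {u : Equiv.Perm (Fin n)}
    (hu : IsColPerm ℓ C u) (k : Fin n) : (u⁻¹ k : ℕ) < ℓ ↔ k ∈ C := by
  rw [← hu.mem_iff]; simp

/-- The permutation `v⁻¹ u` preserves each of the two blocks of positions and is increasing on both,
so its inverse has only ascents and is the identity. -/
theorem IsColPerm.unique {ℓ : ℕ} {C : Finset (Fin n)} {u v : Equiv.Perm (Fin n)}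
    (hu : IsColPerm ℓ C u) (hv : IsColPerm ℓ C v) : u = v := by
  have hx : ∀ k, (v⁻¹ (u k) : ℕ) < ℓ ↔ (k : ℕ) < ℓ := fun k => by
    rw [hv.inv_lt_iff, hu.mem_iff]
  have : (v⁻¹ * u)⁻¹ = 1 := eq_one_of_forall_isAsc fun i => by
    rw [IsAsc, inv_inv, Equiv.Perm.mul_apply, Equiv.Perm.mul_apply]
    have h1 := hx (lo i)
    have h2 := hx (hi i)
    by_cases hs : ((lo i : Fin n) : ℕ) < ℓ ↔ ((hi i : Fin n) : ℕ) < ℓ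
    · have h3 := hu.lt _ _ (lo_lt_hi i) hs
      by_contra hc
      rcases (not_lt.1 hc).lt_or_eq with h | h
      · have := hv.lt _ _ h (by rw [h1, h2, hs])
        exact lt_asymm h3 (by simpa using this)
      · exact h3.ne' (v⁻¹.injective h)
    · have := Fin.lt_def.1 (lo_lt_hi (n := n) i)
      rw [Fin.lt_def]
      omega
  rw [inv_eq_one] at this
  exact (inv_mul_eq_one.1 this).symm

theorem colPerm_of_lt (C : Finset (Fin n)) (k : Fin n) (h : (k : ℕ) < C.card) :
    colPerm C k = C.orderEmbOfFin rfl ⟨k, h⟩ := by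
  have : finCongr (by rw [Finset.card_add_card_compl, Fintype.card_fin]) k =
      Fin.castAdd Cᶜ.card ⟨k, h⟩ := rfl
  rw [colPerm, Equiv.trans_apply, this, Equiv.trans_apply, finSumFinEquiv_symm_apply_castAdd,
    finSumEquivOfFinset_inl]

theorem colPerm_of_le (C : Finset (Fin n)) (k : Fin n) (h : C.card ≤ (k : ℕ)) :
    colPerm C k = Cᶜ.orderEmbOfFin rfl ⟨k - C.card, by
      have := Finset.card_add_card_compl C
      rw [Fintype.card_fin] at this
      omega⟩ := by
  have hk : (k : ℕ) - C.card < Cᶜ.card := by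
    have := Finset.card_add_card_compl C
    rw [Fintype.card_fin] at this
    omega
  have : finCongr (by rw [Finset.card_add_card_compl, Fintype.card_fin]) k =
      Fin.natAdd C.card (⟨k - C.card, hk⟩ : Fin Cᶜ.card) :=
    Fin.ext (by simp; omega)
  rw [colPerm, Equiv.trans_apply, this, Equiv.trans_apply, finSumFinEquiv_symm_apply_natAdd,
    finSumEquivOfFinset_inr]

theorem isColPerm_colPerm (C : Finset (Fin n)) : IsColPerm C.card C (colPerm C) where
  mem_iff k := by
    by_cases h : (k : ℕ) < C.card
    · simp [colPerm_of_lt C k h, h, Finset.orderEmbOfFin_mem]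
    · rw [colPerm_of_le C k (not_lt.1 h)]
      have := Finset.orderEmbOfFin_mem Cᶜ rfl ⟨k - C.card, by
        have := Finset.card_add_card_compl C
        rw [Fintype.card_fin] at this
        omega⟩
      simp [h, Finset.mem_compl.1 this]
  lt a b hab h := by
    rw [Fin.lt_def] at hab
    by_cases ha : (a : ℕ) < C.card
    · rw [colPerm_of_lt C a ha, colPerm_of_lt C b (h.1 ha)]
      exact (Finset.orderEmbOfFin C rfl).strictMono hab
    · rw [colPerm_of_le C a (by omega), colPerm_of_le C b (by omega)]
      refine (Finset.orderEmbOfFin Cᶜ rfl).strictMono ?_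
      rw [Fin.lt_def]
      simp only
      omega

/-! ### Building a column by raising one letter at a time -/

theorem mem_image_simple {i : Fin (n - 1)} {F : Finset (Fin n)} {a : Fin n} :
    a ∈ F.image (simple i) ↔ simple i a ∈ F := by
  rw [Finset.mem_image]
  exact ⟨by rintro ⟨b, hb, rfl⟩; simpa using hb, fun h => ⟨_, h, simple_simple i a⟩⟩

theorem card_image_simple (i : Fin (n - 1)) (F : Finset (Fin n)) :
    (F.image (simple i)).card = F.card := Finset.card_image_of_injective _ (simple i).injective

theorem colPerm_eq_simple_mul {i : Fin (n - 1)} {F : Finset (Fin n)} (h₁ : hi i ∈ F)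
    (h₂ : lo i ∉ F) : colPerm F = simple i * colPerm (F.image (simple i)) := by
  have h := isColPerm_colPerm (F.image (simple i))
  rw [card_image_simple] at h
  refine (isColPerm_colPerm F).unique ⟨fun k => ?_, fun a b hab hs => ?_⟩
  · rw [Equiv.Perm.mul_apply, ← mem_image_simple, h.mem_iff]
  · refine simple_lt_simple (h.lt a b hab hs) ?_
    by_contra! hc
    have ha := h.mem_iff a
    have hb := h.mem_iff b
    rw [hc.1, mem_image_simple, simple_lo] at ha
    rw [hc.2, mem_image_simple, simple_hi] at hb
    tauto

theorem not_isAsc_colPerm_mul {i : Fin (n - 1)} {F : Finset (Fin n)} (h₁ : hi i ∈ F)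
    (h₂ : lo i ∉ F) {v : Equiv.Perm (Fin n)} (hv : v ∈ stab n F.card) :
    ¬ IsAsc i (colPerm F * v) := by
  have h := isColPerm_colPerm F
  rw [← h.inv_lt_iff, ← inv_lt_iff_of_mem_stab hv] at h₁ h₂
  rw [not_isAsc, mul_inv_rev, Equiv.Perm.mul_apply, Equiv.Perm.mul_apply, Fin.lt_def]
  omega

theorem isAsc_colPerm_image {i : Fin (n - 1)} {F : Finset (Fin n)} (h₁ : hi i ∈ F)
    (h₂ : lo i ∉ F) : IsAsc i (colPerm (F.image (simple i))) := by
  have := not_isAsc_colPerm_mul h₁ h₂ (one_mem_stab n _)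
  rwa [mul_one, colPerm_eq_simple_mul h₁ h₂, isAsc_simple_mul, not_not] at this

/-- Induction on columns, raising one entry by one at each step. -/
theorem col_induction {p : Finset (Fin n) → Prop} (base : ∀ F, colPerm F = 1 → p F)
    (step : ∀ (i : Fin (n - 1)) (F : Finset (Fin n)), hi i ∈ F → lo i ∉ F →
      p (F.image (simple i)) → p F) (F : Finset (Fin n)) : p F := by
  induction hk : len (colPerm F) using Nat.strong_induction_on generalizing F with
  | _ k ih =>
  by_cases h1 : colPerm F = 1
  · exact base F h1
  have : ∃ i, ¬ IsAsc i (colPerm F) := by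
    by_contra! h
    exact h1 (eq_one_of_forall_isAsc h)
  obtain ⟨i, hi⟩ := this
  have h := isColPerm_colPerm F
  have hlt := not_isAsc.1 hi
  -- Within a block `u_F` is increasing, so the letters of a descent occupy different blocks; the
  -- larger one comes earlier and hence lies in `F`.
  have hs : ¬ (((colPerm F)⁻¹ (HeckeLift.hi i) : ℕ) < F.card ↔
      ((colPerm F)⁻¹ (lo i) : ℕ) < F.card) := fun hs => by
    have := h.lt _ _ hlt hs
    exact lt_asymm (lo_lt_hi i) (by simpa using this)
  rw [Fin.lt_def] at hlt
  have h₁ : HeckeLift.hi i ∈ F := by rw [← h.inv_lt_iff]; omega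
  have h₂ : lo i ∉ F := by rw [← h.inv_lt_iff]; omega
  refine step i F h₁ h₂ (ih _ ?_ _ rfl)
  have := len_simple_mul (isAsc_colPerm_image h₁ h₂)
  rw [← colPerm_eq_simple_mul h₁ h₂] at this
  omega

/-- `u_F` is the minimal representative of its coset, so lengths add. A descent with `hi i ∈ F` and
`lo i ∉ F` stays a descent after right multiplication by the stabilizer, so the same letters can be
stripped from both sides. -/
theorem Tw_colPerm_mul (F : Finset (Fin n)) {v : Equiv.Perm (Fin n)} (hv : v ∈ stab n F.card) :
    Tw (colPerm F * v) = Tw (colPerm F) * Tw v := by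
  induction F using col_induction with
  | base F h => rw [h, one_mul, Tw_one, one_mul]
  | step i F h₁ h₂ ih =>
    rw [card_image_simple] at ih
    rw [Tw_of_not_isAsc (not_isAsc_colPerm_mul h₁ h₂ hv), colPerm_eq_simple_mul h₁ h₂, mul_assoc,
      simple_mul_cancel, ih hv, Tw_simple_mul (isAsc_colPerm_image h₁ h₂), mul_assoc]

theorem colFactor_of_eq_one {F : Finset (Fin n)} (h : colPerm F = 1) : colFactor F = 1 := by
  simp [colFactor, h]

theorem colFactor_eq {i : Fin (n - 1)} {F : Finset (Fin n)} (h₁ : hi i ∈ F) (h₂ : lo i ∉ F) :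
    colFactor F = t • (((TU i)⁻¹ : (AHA n)ˣ).val * colFactor (F.image (simple i))) := by
  have h := isAsc_colPerm_image h₁ h₂
  rw [colFactor, colPerm_eq_simple_mul h₁ h₂, len_simple_mul h, mul_inv_rev, simple_inv,
    Tw_mul_simple (by rwa [inv_inv]), mul_inv_rev, Units.val_mul, colFactor, mul_smul_comm,
    smul_smul, pow_succ']

/-- The first `ℓ` values of `x`. -/
def headSet (ℓ : ℕ) (x : Equiv.Perm (Fin n)) : Finset (Fin n) := {k | (x⁻¹ k : ℕ) < ℓ}

theorem mem_headSet {ℓ : ℕ} {x : Equiv.Perm (Fin n)} {k : Fin n} :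
    k ∈ headSet ℓ x ↔ (x⁻¹ k : ℕ) < ℓ := by simp [headSet]

theorem headSet_mono {ℓ m : ℕ} (h : ℓ ≤ m) (x : Equiv.Perm (Fin n)) :
    headSet ℓ x ⊆ headSet m x := fun _ hk => mem_headSet.2 ((mem_headSet.1 hk).trans_le h)

theorem headSet_mul {ℓ : ℕ} (x : Equiv.Perm (Fin n)) {v : Equiv.Perm (Fin n)}
    (hv : v ∈ stab n ℓ) : headSet ℓ (x * v) = headSet ℓ x := by
  ext k
  rw [mem_headSet, mem_headSet, mul_inv_rev, Equiv.Perm.mul_apply, inv_lt_iff_of_mem_stab hv]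

theorem headSet_simple_mul (ℓ : ℕ) (i : Fin (n - 1)) (x : Equiv.Perm (Fin n)) :
    headSet ℓ (simple i * x) = (headSet ℓ x).image (simple i) := by
  ext k
  rw [mem_headSet, mem_image_simple, mem_headSet, mul_inv_rev, simple_inv, Equiv.Perm.mul_apply]

theorem headSet_colPerm (F : Finset (Fin n)) : headSet F.card (colPerm F) = F := by
  ext k
  rw [mem_headSet, (isColPerm_colPerm F).inv_lt_iff]

theorem card_headSet {ℓ : ℕ} (h : ℓ ≤ n) (x : Equiv.Perm (Fin n)) : (headSet ℓ x).card = ℓ := by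
  have : headSet ℓ x = (Finset.univ : Finset (Fin ℓ)).map
      ((Fin.castLEEmb h).trans x.toEmbedding) := by
    ext k
    rw [mem_headSet, Finset.mem_map]
    constructor
    · intro hk
      exact ⟨⟨x⁻¹ k, hk⟩, Finset.mem_univ _, by simp⟩
    · rintro ⟨a, -, rfl⟩
      simp
  rw [this, Finset.card_map, Finset.card_fin]

theorem inv_colPerm_headSet_mul_mem_stab {ℓ : ℕ} (h : ℓ ≤ n) (x : Equiv.Perm (Fin n)) :
    (colPerm (headSet ℓ x))⁻¹ * x ∈ stab n ℓ := by
  have hc := isColPerm_colPerm (headSet ℓ x)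
  rw [card_headSet h] at hc
  refine mem_stab_iff.2 fun k => ?_
  rw [Equiv.Perm.mul_apply, hc.inv_lt_iff, mem_headSet, ← Equiv.Perm.mul_apply, inv_mul_cancel,
    Equiv.Perm.one_apply]

/-! ### Dominance of columns -/

/-- There is an injection from `D` to `A` that does not raise any letter. -/
def Dominates (A D : Finset (Fin n)) : Prop :=
  ∃ φ : Fin n → Fin n, Set.InjOn φ D ∧ ∀ d ∈ D, φ d ∈ A ∧ φ d ≤ d

theorem Dominates.refl (A : Finset (Fin n)) : Dominates A A :=
  ⟨id, Function.injective_id.injOn, fun _ hd => ⟨hd, le_rfl⟩⟩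

theorem Dominates.superset {A B D : Finset (Fin n)} (h : Dominates A D) (hAB : A ⊆ B) :
    Dominates B D := by
  obtain ⟨φ, h1, h2⟩ := h
  exact ⟨φ, h1, fun d hd => ⟨hAB (h2 d hd).1, (h2 d hd).2⟩⟩

theorem lo_le_simple {i : Fin (n - 1)} {a b : Fin n} (h : a ≤ simple i b) (hb : b ≠ lo i) :
    a ≤ b := by
  by_cases h' : b = hi i
  · subst h'
    rw [simple_hi] at h
    exact h.trans (lo_lt_hi i).le
  · rwa [simple_of_ne hb h'] at h

theorem Dominates.of_image {i : Fin (n - 1)} {A F : Finset (Fin n)} (h₂ : lo i ∉ F)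
    (h : Dominates A (F.image (simple i))) : Dominates A F := by
  obtain ⟨φ, h1, h2⟩ := h
  have hm : ∀ d ∈ F, simple i d ∈ F.image (simple i) := fun d hd => Finset.mem_image_of_mem _ hd
  refine ⟨φ ∘ simple i, fun a ha b hb hab => (simple i).injective (h1 (hm a ha) (hm b hb) hab),
    fun d hd => ⟨(h2 _ (hm d hd)).1, ?_⟩⟩
  exact lo_le_simple (h2 _ (hm d hd)).2 fun e => h₂ (e ▸ hd)

/-- Conjugating the injection by `s_i` could only spoil an inequality `φ d ≤ d` with `φ d = lo i`
and `d = hi i`. But `hi i` lies in the image of `F` only if `lo i ∈ F`, which is excluded. -/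
theorem Dominates.image {i : Fin (n - 1)} {A F : Finset (Fin n)} (h₂ : lo i ∉ F)
    (h : Dominates A (F.image (simple i))) : Dominates (A.image (simple i)) F := by
  obtain ⟨φ, h1, h2⟩ := h
  have hm : ∀ d ∈ F, simple i d ∈ F.image (simple i) := fun d hd => Finset.mem_image_of_mem _ hd
  refine ⟨simple i ∘ φ ∘ simple i, fun a ha b hb hab =>
    (simple i).injective (h1 (hm a ha) (hm b hb) ((simple i).injective hab)), fun d hd =>
    ⟨Finset.mem_image_of_mem _ (h2 _ (hm d hd)).1, ?_⟩⟩
  rcases (h2 _ (hm d hd)).2.lt_or_eq with h | h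
  · have := simple_lt_simple (i := i) h (Or.inr fun e => h₂ ?_)
    · simpa using this.le
    · rw [← simple_hi i, ← e, simple_simple]
      exact hd
  · simp [h]

/-- Pigeonhole: if the `i`-th entry of `A` exceeded that of `D`, the `i + 1` smallest entries of `D`
would inject into the `i` smallest entries of `A`. -/
theorem Dominates.rowLE {A D : Finset (Fin n)} (h : Dominates A D) : RowLE A D := by
  obtain ⟨φ, h1, h2⟩ := h
  intro i hA hD
  by_contra! hc
  set a := A.orderEmbOfFin rfl
  set d := D.orderEmbOfFin rfl
  have hsub : ((Finset.univ.filter fun j : Fin D.card => (j : ℕ) ≤ i).image fun j => φ (d j)) ⊆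
      (Finset.univ.filter fun j : Fin A.card => (j : ℕ) < i).image a := by
    intro x hx
    obtain ⟨j, hj, rfl⟩ := Finset.mem_image.1 hx
    have hj' : j ≤ ⟨i, hD⟩ := (Finset.mem_filter.1 hj).2
    obtain ⟨hm, hle⟩ := h2 (d j) (Finset.orderEmbOfFin_mem _ _ _)
    have : φ (d j) ∈ Set.range a := by rw [Finset.range_orderEmbOfFin]; exact hm
    obtain ⟨k, hk⟩ := this
    refine Finset.mem_image.2 ⟨k, Finset.mem_filter.2 ⟨Finset.mem_univ _, ?_⟩, hk⟩
    have : a k < a ⟨i, hA⟩ := by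
      rw [hk]
      exact (hle.trans (d.monotone hj')).trans_lt hc
    exact a.lt_iff_lt.1 this
  have hcard := Finset.card_le_card hsub
  rw [Finset.card_image_of_injective _ a.injective, Finset.card_image_of_injective] at hcard
  · have e1 : (Finset.univ.filter fun j : Fin D.card => (j : ℕ) ≤ i) = Finset.Iic ⟨i, hD⟩ := by
      ext j; simp [Fin.le_def]
    have e2 : (Finset.univ.filter fun j : Fin A.card => (j : ℕ) < i) = Finset.Iio ⟨i, hA⟩ := by
      ext j; simp [Fin.lt_def]
    rw [e1, e2, Fin.card_Iic, Fin.card_Iio] at hcard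
    simp at hcard
  · intro j k hjk
    exact d.injective (h1 (Finset.orderEmbOfFin_mem _ _ _) (Finset.orderEmbOfFin_mem _ _ _) hjk)

/-- The length condition guarantees that the middle column meets every row used in the comparison;
without it transitivity can fail. -/
theorem RowLE.trans {A B C : Finset (Fin n)} (h : C.card ≤ B.card) (h₁ : RowLE A B)
    (h₂ : RowLE B C) : RowLE A C := fun i hA hC =>
  (h₁ i hA (hC.trans_le h)).trans (h₂ i (hC.trans_le h) hC)

theorem colFactor_mem_TSpan (F : Finset (Fin n)) :
    colFactor F ∈ TSpan {x | Dominates (headSet F.card x) F} := by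
  induction F using col_induction with
  | base F h =>
    rw [colFactor_of_eq_one h, ← Units.val_one, ← Tw_one]
    refine Tw_mem_TSpan ?_
    rw [Set.mem_ofPred_eq, ← h, headSet_colPerm]
    exact Dominates.refl F
  | step i F h₁ h₂ ih =>
    rw [card_image_simple] at ih
    rw [colFactor_eq h₁ h₂]
    refine Submodule.smul_mem _ _ (TU_inv_mul_mem_TSpan ?_ ?_ ih)
    · exact fun x hx => Dominates.of_image h₂ hx
    · intro x hx
      rw [Set.mem_ofPred_eq, headSet_simple_mul]
      exact Dominates.image h₂ hx

/-! ### Parabolic decompositions -/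

theorem mem_colSet {ℓ : ℕ} {F : Finset (Fin n)} : F ∈ colSet n ℓ ↔ F.card = ℓ := by
  simp [colSet, Finset.mem_powersetCard]

theorem exists_isParDecomp {ℓ : ℕ} (hℓ : ℓ ≤ n) {h : AHA n} (hh : h ∈ TSpan Set.univ) :
    ∃ f, IsParDecomp ℓ h f := by
  classical
  induction hh using Submodule.span_induction with
  | mem x hx =>
    obtain ⟨w, -, rfl⟩ := hx
    have hv := inv_colPerm_headSet_mul_mem_stab hℓ w
    refine ⟨fun F => if F = headSet ℓ w then
      (Tw ((colPerm (headSet ℓ w))⁻¹ * w) : AHA n) else 0, fun F _ => ?_, ?_⟩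
    · simp only
      split_ifs
      · exact Tw_mem_parSubalgebra hv
      · exact zero_mem _
    · simp only [mul_ite, mul_zero, Finset.sum_ite_eq']
      rw [if_pos (mem_colSet.2 (card_headSet hℓ w)), ← Units.val_mul, ← Tw_colPerm_mul,
        mul_inv_cancel_left]
      rwa [card_headSet hℓ]
  | zero => exact ⟨0, fun _ _ => zero_mem _, by simp⟩
  | add x y _ _ hx hy =>
    obtain ⟨f, hf, rfl⟩ := hx
    obtain ⟨g, hg, rfl⟩ := hy
    exact ⟨f + g, fun F hF => add_mem (hf F hF) (hg F hF), by
      simp [mul_add, Finset.sum_add_distrib]⟩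
  | smul c x _ hx =>
    obtain ⟨f, hf, rfl⟩ := hx
    exact ⟨c • f, fun F hF => Subalgebra.smul_mem _ (hf F hF) c, by
      simp [Finset.smul_sum]⟩

theorem isParDecomp_parCoeff {ℓ : ℕ} (hℓ : ℓ ≤ n) {h : AHA n} (hh : h ∈ TSpan Set.univ) :
    IsParDecomp ℓ h (parCoeff ℓ h) := by
  have := exists_isParDecomp hℓ hh
  rw [parCoeff, dif_pos this]
  exact Classical.choose_spec this

theorem parCoeff_mem {ℓ : ℕ} (h : AHA n) {F : Finset (Fin n)} (hF : F ∈ colSet n ℓ) :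
    parCoeff ℓ h F ∈ parSubalgebra (fundWt n ℓ) := by
  rw [parCoeff]
  split_ifs with hex
  · exact (Classical.choose_spec hex).1 F hF
  · exact zero_mem _

theorem parSymmetrizer_mem (n ℓ : ℕ) :
    parSymmetrizer (fundWt n ℓ) ∈ parSubalgebra (fundWt n ℓ) :=
  sum_mem fun _ hw => Tw_mem_parSubalgebra (Finset.mem_filter.1 hw).2

/-- Each `w` factors uniquely as `u_F v` with `v` in the stabilizer, and `T_w = T_{u_F} T_v`. This
makes the single-column clause of `Psi` an instance of the recursion started at `1_0`. -/
theorem isParDecomp_symmetrizer {ℓ : ℕ} (hℓ : ℓ ≤ n) :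
    IsParDecomp ℓ (symmetrizer n) fun _ => parSymmetrizer (fundWt n ℓ) := by
  refine ⟨fun _ _ => parSymmetrizer_mem n ℓ, ?_⟩
  simp only [parSymmetrizer, Finset.mul_sum]
  rw [← Finset.sum_product', symmetrizer]
  refine Finset.sum_bij' (fun w _ => (headSet ℓ w, (colPerm (headSet ℓ w))⁻¹ * w))
    (fun p _ => colPerm p.1 * p.2) ?_ ?_ ?_ ?_ ?_
  · intro w _
    exact Finset.mem_product.2 ⟨mem_colSet.2 (card_headSet hℓ w), Finset.mem_filter.2
      ⟨Finset.mem_univ _, inv_colPerm_headSet_mul_mem_stab hℓ w⟩⟩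
  · exact fun _ _ => Finset.mem_univ _
  · exact fun w _ => mul_inv_cancel_left _ _
  · rintro ⟨F, v⟩ hp
    obtain ⟨hF, hv⟩ := Finset.mem_product.1 hp
    have hF' : F.card = ℓ := mem_colSet.1 hF
    have hv' : v ∈ stab n ℓ := (Finset.mem_filter.1 hv).2
    have : headSet ℓ (colPerm F * v) = F := by
      rw [headSet_mul _ hv', ← hF', headSet_colPerm]
    simp only [this, inv_mul_cancel_left]
  · intro w _
    rw [← Units.val_mul, ← Tw_colPerm_mul, mul_inv_cancel_left]
    rw [card_headSet hℓ]
    exact inv_colPerm_headSet_mul_mem_stab hℓ w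

end Columns

/-! ### The regular representation and linear independence of the `T_w` -/

section JucysMurphy

variable {A : Type*} [Ring A] [Algebra R A]

/-- The multiplicative Jucys–Murphy elements attached to a sequence `τ`. -/
noncomputable def jm (c : R) (τ : ℕ → A) : ℕ → A
  | 0 => 1
  | k + 1 => c • (τ k * jm c τ k * τ k)

theorem commute_jm {c : R} {τ : ℕ → A} {z : A} {k : ℕ} (h : ∀ i < k, Commute z (τ i)) :
    Commute z (jm c τ k) := by
  induction k with
  | zero => exact Commute.one_right z
  | succ k ih =>
    have hk := h k (by omega)
    exact (((hk.mul_right (ih fun i hi => h i (by omega))).mul_right hk)).smul_right c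

/-- At `k = i + 2` the braid relation moves `τ i` through the outer factors, turning it into `τ (i +
1)` at the centre, which commutes with the inner element. Larger `k` adds only factors far from `i`.
-/
theorem commute_jm_of_add_two_le {c : R} {τ : ℕ → A} {i k : ℕ}
    (hfar : ∀ i j, i + 2 ≤ j → Commute (τ i) (τ j))
    (hbraid : τ i * τ (i + 1) * τ i = τ (i + 1) * τ i * τ (i + 1)) (h : i + 2 ≤ k) :
    Commute (τ i) (jm c τ k) := by
  induction k, h using Nat.le_induction with
  | base =>
    have h1 : Commute (τ (i + 1)) (jm c τ i) := commute_jm fun j hj => (hfar _ _ (by omega)).symm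
    simp only [jm, mul_smul_comm, smul_mul_assoc]
    refine (Commute.smul_right (Commute.smul_right ?_ c) c)
    set Y := jm c τ i
    set a := τ i
    set b := τ (i + 1)
    have h1 : b * Y = Y * b := h1
    change a * (b * (a * Y * a) * b) = b * (a * Y * a) * b * a
    calc a * (b * (a * Y * a) * b) = (a * b * a) * Y * a * b := by simp only [mul_assoc]
      _ = b * a * (b * Y) * a * b := by rw [hbraid]; simp only [mul_assoc]
      _ = b * a * Y * (b * a * b) := by rw [h1]; simp only [mul_assoc]
      _ = b * (a * Y * a) * b * a := by rw [← hbraid]; simp only [mul_assoc]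
  | succ k hk ih =>
    have hk := hfar i k hk
    exact ((hk.mul_right ih).mul_right hk).smul_right c

theorem jm_mul_jm {c c' : R} {τ τ' : ℕ → A} (hc : c * c' = 1) (h : ∀ k, τ k * τ' k = 1) (k : ℕ) :
    jm c τ k * jm c' τ' k = 1 := by
  induction k with
  | zero => exact one_mul 1
  | succ k ih =>
    rw [jm, jm, smul_mul_smul_comm, hc, one_smul]
    calc τ k * jm c τ k * τ k * (τ' k * jm c' τ' k * τ' k)
        = τ k * jm c τ k * (τ k * τ' k) * jm c' τ' k * τ' k := by simp only [mul_assoc]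
      _ = τ k * (jm c τ k * jm c' τ' k) * τ' k := by rw [h, mul_one]; simp only [mul_assoc]
      _ = 1 := by rw [ih, mul_one, h]

end JucysMurphy

/-! ### A representation of the affine algebra extending the finite regular one -/

section Regular

variable {n : ℕ}

open Classical in
/-- The action of `T_i` on the functions on `S_n`, for the left regular representation of the
finite Hecke algebra. -/
noncomputable def regT (i : Fin (n - 1)) : Module.End R (Equiv.Perm (Fin n) → R) where
  toFun f w := if IsAsc i w then t * f (simple i * w) else f (simple i * w) + (t - 1) * f w
  map_add' f g := by
    ext1 w
    simp only [Pi.add_apply]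
    split_ifs <;> ring
  map_smul' c f := by
    ext1 w
    simp only [Pi.smul_apply, smul_eq_mul, RingHom.id_apply]
    split_ifs <;> ring

theorem regT_apply_of_isAsc {i : Fin (n - 1)} {w : Equiv.Perm (Fin n)} (h : IsAsc i w)
    (f : Equiv.Perm (Fin n) → R) : regT i f w = t * f (simple i * w) := if_pos h

theorem regT_apply_of_not_isAsc {i : Fin (n - 1)} {w : Equiv.Perm (Fin n)} (h : ¬ IsAsc i w)
    (f : Equiv.Perm (Fin n) → R) : regT i f w = f (simple i * w) + (t - 1) * f w := if_neg h

/-- A function `f` stands for the formal sum of the `f w T_w`; `regT` records the coefficients after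
left multiplication by `T_i`, and the relations are checked pointwise. -/
theorem regT_sq (i : Fin (n - 1)) :
    (regT i * regT i : Module.End R (Equiv.Perm (Fin n) → R)) = (t - 1) • regT i + t • 1 := by
  refine LinearMap.ext fun f => funext fun w => ?_
  simp only [Module.End.mul_apply, LinearMap.add_apply, LinearMap.smul_apply, Pi.add_apply,
    Pi.smul_apply, smul_eq_mul, Module.End.one_apply]
  by_cases h : IsAsc i w
  · have h' : ¬ IsAsc i (simple i * w) := by rwa [isAsc_simple_mul, not_not]
    rw [regT_apply_of_isAsc h, regT_apply_of_isAsc h, regT_apply_of_not_isAsc h',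
      simple_mul_cancel]
    ring
  · have h' : IsAsc i (simple i * w) := by rwa [isAsc_simple_mul]
    rw [regT_apply_of_not_isAsc h, regT_apply_of_isAsc h', simple_mul_cancel,
      regT_apply_of_not_isAsc h]
    ring

theorem regT_comm {i j : Fin (n - 1)} (h : (i : ℕ) + 1 < j ∨ (j : ℕ) + 1 < i) :
    (regT i * regT j : Module.End R (Equiv.Perm (Fin n) → R)) = regT j * regT i := by
  refine LinearMap.ext fun f => funext fun w => ?_
  have e : simple i * (simple j * w) = simple j * (simple i * w) := by
    rw [← mul_assoc, simple_comm h, mul_assoc]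
  have hi := isAsc_simple_mul_of_far h w
  have hj := isAsc_simple_mul_of_far h.symm w
  by_cases c1 : IsAsc i w <;> by_cases c2 : IsAsc j w <;>
    simp only [Module.End.mul_apply, regT_apply_of_isAsc, regT_apply_of_not_isAsc, hi, hj, e, c1,
      c2, not_false_eq_true] <;> ring

theorem regT_braid {i j : Fin (n - 1)} (h : (j : ℕ) = i + 1) :
    (regT i * regT j * regT i : Module.End R (Equiv.Perm (Fin n) → R)) =
      regT j * regT i * regT j := by
  refine LinearMap.ext fun f => funext fun w => ?_
  have e : simple i * (simple j * (simple i * w)) = simple j * (simple i * (simple j * w)) := by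
    simp only [← mul_assoc, simple_braid h]
  have h1 := isAsc_succ_simple_mul h w
  have h2 := isAsc_simple_succ_mul h w
  have h3 := isAsc_simple_succ_mul_simple_mul h w
  have h4 := isAsc_succ_simple_mul_simple_succ_mul h w
  -- Which of `i`, `j` are ascents along the braid orbit depends only on the relative order of the
  -- positions of three consecutive letters; `hP` and `hN` exclude the inconsistent sign patterns.
  have hP : w⁻¹ (lo i) < w⁻¹ (hi j) → IsAsc i w ∨ IsAsc j w := by
    rw [isAsc_succ h, IsAsc]
    intro hlt
    by_contra! hc
    exact absurd hlt (hc.2.trans hc.1).not_gt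
  have hN : IsAsc i w → IsAsc j w → w⁻¹ (lo i) < w⁻¹ (hi j) := by
    rw [isAsc_succ h, IsAsc]
    exact lt_trans
  simp only [Module.End.mul_apply]
  by_cases c1 : IsAsc i w <;> by_cases c2 : IsAsc j w
  · have c3 := hN c1 c2
    simp only [regT_apply_of_isAsc, h1, h2, h3, h4, e, c1, c2, c3]
  · by_cases c3 : w⁻¹ (lo i) < w⁻¹ (hi j)
    all_goals
      simp only [regT_apply_of_isAsc, regT_apply_of_not_isAsc, h1, h2, h3, h4, e,
        isAsc_simple_mul, simple_mul_cancel, c1, c2, c3, not_true_eq_false, not_false_eq_true]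
      ring
  · by_cases c3 : w⁻¹ (lo i) < w⁻¹ (hi j)
    all_goals
      simp only [regT_apply_of_isAsc, regT_apply_of_not_isAsc, h1, h2, h3, h4, e,
        isAsc_simple_mul, simple_mul_cancel, c1, c2, c3, not_true_eq_false, not_false_eq_true]
      ring
  · have c3 : ¬ w⁻¹ (lo i) < w⁻¹ (hi j) := fun c3 => (hP c3).elim c1 c2
    simp only [regT_apply_of_isAsc, regT_apply_of_not_isAsc, h1, h2, h3, h4, e,
      isAsc_simple_mul, simple_mul_cancel, c1, c2, c3, not_false_eq_true]
    ring

/-- The sequence of the operators `regT i`, extended by the identity. -/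
noncomputable def regSeq (n k : ℕ) : Module.End R (Equiv.Perm (Fin n) → R) :=
  if h : k < n - 1 then regT ⟨k, h⟩ else 1

/-- The inverses of the operators `regSeq n k`. -/
noncomputable def regSeqInv (n k : ℕ) : Module.End R (Equiv.Perm (Fin n) → R) :=
  if h : k < n - 1 then (LaurentPolynomial.T (-1) : R) • (regT ⟨k, h⟩ + (1 - t) • 1) else 1

theorem regSeq_val (i : Fin (n - 1)) : regSeq n i = regT i := dif_pos i.2

theorem regSeq_mul_regSeqInv (k : ℕ) : regSeq n k * regSeqInv n k = 1 := by
  rw [regSeq, regSeqInv]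
  split_ifs with h
  · rw [mul_smul_comm, mul_add, regT_sq, mul_smul_comm, mul_one, add_right_comm, ← add_smul,
      show t - 1 + (1 - t) = (0 : R) by ring, zero_smul, zero_add, smul_smul, mul_comm,
      t_mul_inv, one_smul]
  · exact one_mul 1

theorem regSeqInv_mul_regSeq (k : ℕ) : regSeqInv n k * regSeq n k = 1 := by
  rw [regSeq, regSeqInv]
  split_ifs with h
  · rw [smul_mul_assoc, add_mul, regT_sq, smul_mul_assoc, one_mul, add_right_comm, ← add_smul,
      show t - 1 + (1 - t) = (0 : R) by ring, zero_smul, zero_add, smul_smul, mul_comm,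
      t_mul_inv, one_smul]
  · exact one_mul 1

theorem regSeq_commute (i j : ℕ) (h : i + 2 ≤ j) : Commute (regSeq n i) (regSeq n j) := by
  rw [regSeq, regSeq]
  split_ifs
  · exact regT_comm (Or.inl (by simp only; omega))
  all_goals simp

/-- The images of the generators: the `X_j` act as Jucys–Murphy elements. -/
noncomputable def regGen : Gen n → Module.End R (Equiv.Perm (Fin n) → R)
  | Gen.T i => regT i
  | Gen.X j => jm (LaurentPolynomial.T (-1)) (regSeq n) j
  | Gen.Xinv j => jm t (regSeqInv n) j

theorem commute_regSeq_jm {c : R} {i k : ℕ} (hi : i + 1 < n - 1) (h : i + 2 ≤ k) :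
    Commute (regSeq n i) (jm c (regSeq n) k) := by
  refine commute_jm_of_add_two_le regSeq_commute ?_ h
  rw [regSeq, regSeq, dif_pos hi, dif_pos (by omega)]
  exact regT_braid rfl

theorem commute_jm_jm {c : R} {j k : ℕ} (hk : k < n) (h : j < k) :
    Commute (jm c (regSeq n) k) (jm c (regSeq n) j) :=
  commute_jm fun i _ => (commute_regSeq_jm (by omega) (by omega)).symm

/-- Setting `X_1 = 1` and solving the cross relation for `X_{i+1}` forces the Jucys–Murphy recursion
with constant `t⁻¹`. The remaining relations are its commutation properties. -/
theorem lift_regGen_rel {a b : FreeAlgebra R (Gen n)} (h : Rel n a b) :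
    FreeAlgebra.lift R regGen a = FreeAlgebra.lift R regGen b := by
  induction h with
  | quad i => simpa [regGen] using regT_sq i
  | braid i j h => simpa [regGen] using regT_braid h
  | far i j h => simpa [regGen] using regT_comm h
  | mul_inv j =>
    simpa [regGen] using jm_mul_jm ((mul_comm _ _).trans t_mul_inv) regSeq_mul_regSeqInv (j : ℕ)
  | inv_mul j => simpa [regGen] using jm_mul_jm t_mul_inv regSeqInv_mul_regSeq (j : ℕ)
  | comm i j =>
    simp only [map_mul, FreeAlgebra.lift_ι_apply, regGen]
    rcases lt_trichotomy (i : ℕ) j with h | h | h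
    · exact (commute_jm_jm j.2 h).symm
    · rw [h]
    · exact commute_jm_jm i.2 h
  | cross i =>
    simp only [map_mul, map_smul, FreeAlgebra.lift_ι_apply, regGen, lo, hi, jm]
    rw [smul_smul, t_mul_inv, one_smul, regSeq_val]
  | cross_far i j h₁ h₂ =>
    simp only [map_mul, FreeAlgebra.lift_ι_apply, regGen]
    rw [← regSeq_val]
    have h₁ := Fin.val_ne_of_ne h₁
    have h₂ := Fin.val_ne_of_ne h₂
    simp only [lo, hi] at h₁ h₂
    rcases lt_or_gt_of_ne h₁ with h | h
    · exact commute_jm fun k hk => (regSeq_commute k i (by omega)).symm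
    · exact commute_regSeq_jm (by omega) (by omega)

/-- The representation of the affine Hecke algebra on the functions on `S_n`. -/
noncomputable def reg (n : ℕ) : AHA n →ₐ[R] Module.End R (Equiv.Perm (Fin n) → R) :=
  RingQuot.liftAlgHom R ⟨FreeAlgebra.lift R regGen, fun {_ _} => lift_regGen_rel⟩

theorem reg_TU (i : Fin (n - 1)) : reg n (TU i : AHA n) = regT i := by
  change RingQuot.liftAlgHom R _ (RingQuot.mkAlgHom R (Rel n) (fT i)) = _
  rw [RingQuot.liftAlgHom_mkAlgHom_apply, FreeAlgebra.lift_ι_apply]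
  rfl

theorem regT_single {i : Fin (n - 1)} {w : Equiv.Perm (Fin n)} (h : IsAsc i w) :
    regT i (Pi.single w 1) = Pi.single (simple i * w) 1 := by
  funext x
  by_cases hx : x = simple i * w
  · subst hx
    have h' : ¬ IsAsc i (simple i * w) := by rwa [isAsc_simple_mul, not_not]
    have hne : simple i * w ≠ w := fun e => by rw [e] at h'; exact h' h
    rw [regT_apply_of_not_isAsc h', simple_mul_cancel, Pi.single_eq_same, Pi.single_eq_same,
      Pi.single_eq_of_ne hne, mul_zero, add_zero]
  · have hx' : simple i * x ≠ w := fun e => hx (by rw [← e, simple_mul_cancel])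
    rw [Pi.single_eq_of_ne hx]
    by_cases hi : IsAsc i x
    · rw [regT_apply_of_isAsc hi, Pi.single_eq_of_ne hx', mul_zero]
    · rw [regT_apply_of_not_isAsc hi, Pi.single_eq_of_ne hx',
        Pi.single_eq_of_ne (fun e : x = w => hi (e ▸ h)), mul_zero, add_zero]

theorem reg_Tw (w : Equiv.Perm (Fin n)) :
    reg n (Tw w : AHA n) (Pi.single 1 1) = Pi.single w 1 := by
  refine stab_induction (ℓ := 0)
    (p := fun w => reg n (Tw w : AHA n) (Pi.single 1 1) = Pi.single w 1) ?_ ?_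
    (mem_stab_iff.2 fun k => by simp)
  · simp
  · intro i w _ _ ha ih
    rw [Tw_simple_mul ha, Units.val_mul, map_mul, Module.End.mul_apply, ih, reg_TU,
      regT_single ha]

/-- Acting on the delta function at `1`, the `T_w` give the delta functions at `w`, which are
independent. -/
theorem linearIndependent_Tw : LinearIndependent R fun w : Equiv.Perm (Fin n) => (Tw w : AHA n) := by
  refine LinearIndependent.of_comp
    ((LinearMap.applyₗ (Pi.single 1 1 : Equiv.Perm (Fin n) → R)).comp (reg n).toLinearMap) ?_
  convert (Pi.basisFun R (Equiv.Perm (Fin n))).linearIndependent using 1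
  funext w
  simpa using reg_Tw w

end Regular

/-! ### Uniqueness of parabolic decompositions -/

section Uniqueness

variable {n : ℕ}

theorem Tw_colPerm_mul_mem_TSpan (F : Finset (Fin n)) {g : AHA n}
    (hg : g ∈ parSubalgebra (fundWt n F.card)) :
    (Tw (colPerm F) : AHA n) * g ∈ TSpan {x | headSet F.card x = F} := by
  refine mul_mem_TSpan (fun x hx v hv => ?_) (Tw_mem_TSpan (headSet_colPerm F)) hg
  rw [Set.mem_ofPred_eq, headSet_mul x hv]
  exact hx

/-- The term at `C` is supported on the coset `u_C S_{n,ϖ_ℓ}`. It is also `h` minus the other terms,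
hence supported off that coset, so it vanishes; and `T_{u_C}` is a unit. This applies to any
decomposition, in particular to the chosen `parCoeff`. -/
theorem IsParDecomp.eq_zero {ℓ : ℕ} {h : AHA n} {f : Finset (Fin n) → AHA n}
    (hf : IsParDecomp ℓ h f) {A : Set (Equiv.Perm (Fin n))} (hA : h ∈ TSpan A)
    {C : Finset (Fin n)} (hC : C.card = ℓ) (hne : ∀ x ∈ A, headSet ℓ x ≠ C) : f C = 0 := by
  have hCm := mem_colSet.2 hC
  have hmem : (Tw (colPerm C) : AHA n) * f C ∈ TSpan {x | headSet ℓ x ≠ C} := by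
    have : (Tw (colPerm C) : AHA n) * f C =
        h + (-1 : R) • ∑ E ∈ (colSet n ℓ).erase C, (Tw (colPerm E) : AHA n) * f E := by
      conv_rhs => rw [hf.2, ← Finset.add_sum_erase _ _ hCm, add_assoc]
      conv_rhs => enter [2, 1]; rw [← one_smul R (Finset.sum _ _)]
      rw [← add_smul, add_neg_cancel, zero_smul, add_zero]
    rw [this]
    refine add_mem (TSpan_mono hne hA) (Submodule.smul_mem _ _ (sum_mem fun E hE => ?_))
    obtain ⟨hEC, hE⟩ := Finset.mem_erase.1 hE
    obtain rfl := mem_colSet.1 hE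
    refine TSpan_mono (fun x hx => ?_) (Tw_colPerm_mul_mem_TSpan E (hf.1 E hE))
    rw [Set.mem_ofPred_eq] at hx ⊢
    rwa [hx]
  have hmem' : (Tw (colPerm C) : AHA n) * f C ∈ TSpan {x | headSet ℓ x = C} := by
    subst hC
    exact Tw_colPerm_mul_mem_TSpan C (hf.1 C hCm)
  have hd := linearIndependent_Tw.disjoint_span_image (s := {x | headSet ℓ x ≠ C})
    (t := {x | headSet ℓ x = C}) (Set.disjoint_left.2 fun x h1 h2 => h1 h2)
  exact (Units.mul_right_eq_zero _).1 (Submodule.disjoint_def.1 hd _ hmem hmem')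

end Uniqueness

/-! ### Monomials -/

section Monomials

variable {n : ℕ}

theorem XU_commute (i j : Fin n) : Commute (XU i) (XU j) :=
  Units.ext (by simpa only [map_mul] using! quo_rel (Rel.comm i j))

theorem Xpow_add (μ ν : Fin n → ℤ) : Xpow (μ + ν) = Xpow μ * Xpow ν := by
  have key : ∀ l : List (Fin n), (l.map fun j => XU j ^ (μ + ν) j).prod =
      (l.map fun j => XU j ^ μ j).prod * (l.map fun j => XU j ^ ν j).prod := by
    intro l
    induction l with
    | nil => simp
    | cons j l ih =>
      have hc : Commute (XU j ^ ν j) (l.map fun j => XU j ^ μ j).prod := by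
        refine Commute.list_prod_right _ _ fun x hx => ?_
        obtain ⟨k, -, rfl⟩ := List.mem_map.1 hx
        exact ((XU_commute j k).zpow_left _).zpow_right _
      simp only [List.map_cons, List.prod_cons]
      rw [ih, Pi.add_apply, zpow_add, mul_assoc, mul_assoc, ← mul_assoc (XU j ^ ν j), hc.eq,
        mul_assoc]
  rw [Xpow, Xpow, Xpow, ← Units.val_mul, List.ofFn_eq_map, List.ofFn_eq_map, List.ofFn_eq_map, key]

theorem Xpow_zero : Xpow (0 : Fin n → ℤ) = 1 := by
  simp [Xpow, List.ofFn_eq_map]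

theorem Xpow_single (j : Fin n) : Xpow (Pi.single j 1) = (XU j : AHA n) := by
  rw [Xpow, List.ofFn_eq_map, List.prod_map_eq_pow_single j, Pi.single_eq_same,
    List.count_eq_one_of_mem (List.nodup_finRange n) (List.mem_finRange j), zpow_one, pow_one]
  intro k hk _
  rw [Pi.single_eq_of_ne hk, zpow_zero]

theorem TU_mul_Xpow_comm {i : Fin (n - 1)} {μ : Fin n → ℤ} (h₁ : μ (lo i) = 0)
    (h₂ : μ (hi i) = 0) : (TU i : AHA n) * Xpow μ = Xpow μ * TU i := by
  have : Commute (TU i) (List.ofFn fun j => XU j ^ μ j).prod := by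
    refine Commute.list_prod_right _ _ fun x hx => ?_
    obtain ⟨j, rfl⟩ := List.mem_ofFn.1 hx
    by_cases hj₁ : j = lo i
    · simp [hj₁, h₁]
    by_cases hj₂ : j = hi i
    · simp [hj₂, h₂]
    refine Commute.zpow_right ?_ _
    exact Units.ext (by simpa only [map_mul] using! quo_rel (Rel.cross_far i j hj₁ hj₂))
  rw [Xpow, ← Units.val_mul, this.eq, Units.val_mul]

theorem TU_inv_mul_Xpow_comm {i : Fin (n - 1)} {μ : Fin n → ℤ} (h₁ : μ (lo i) = 0)
    (h₂ : μ (hi i) = 0) : ((TU i)⁻¹ : (AHA n)ˣ).val * Xpow μ =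
      Xpow μ * ((TU i)⁻¹ : (AHA n)ˣ).val := by
  rw [Units.inv_mul_eq_iff_eq_mul, ← mul_assoc, TU_mul_Xpow_comm h₁ h₂, mul_assoc, Units.mul_inv,
    mul_one]

theorem TU_mul_XU_mul_TU (i : Fin (n - 1)) :
    (TU i : AHA n) * XU (lo i) * TU i = t • (XU (hi i) : AHA n) := by
  simpa only [map_mul, map_smul] using! quo_rel (Rel.cross i)

theorem TU_mul_XU_lo (i : Fin (n - 1)) :
    (TU i : AHA n) * XU (lo i) = t • ((XU (hi i) : AHA n) * ((TU i)⁻¹ : (AHA n)ˣ).val) := by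
  rw [← smul_mul_assoc, ← TU_mul_XU_mul_TU, mul_assoc, Units.mul_inv, mul_one]

theorem smul_TU_inv_mul_XU_hi (i : Fin (n - 1)) :
    t • (((TU i)⁻¹ : (AHA n)ˣ).val * (XU (hi i) : AHA n)) = XU (lo i) * TU i := by
  rw [← mul_smul_comm, ← TU_mul_XU_mul_TU, mul_assoc, Units.inv_mul_cancel_left]

theorem TU_mul_XU_mul_XU (i : Fin (n - 1)) :
    (TU i : AHA n) * (XU (lo i) * XU (hi i)) = XU (lo i) * XU (hi i) * (TU i : AHA n) := by
  have hc : (XU (hi i) * XU (lo i) : AHA n) = XU (lo i) * XU (hi i) := by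
    rw [← Units.val_mul, (XU_commute (hi i) (lo i)).eq, Units.val_mul]
  rw [← mul_assoc, TU_mul_XU_lo, smul_mul_assoc, mul_assoc, ← mul_smul_comm,
    smul_TU_inv_mul_XU_hi, ← mul_assoc, hc]

/-- The sum of the `ε_k`, `k ∈ F`. -/
def colWt (F : Finset (Fin n)) : Fin n → ℤ := fun k => if k ∈ F then 1 else 0

theorem colWt_eq_single_add {F : Finset (Fin n)} {a : Fin n} (h : a ∈ F) :
    colWt F = Pi.single a 1 + colWt (F.erase a) := by
  funext k
  by_cases hk : k = a
  · subst hk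
    simp [colWt, h]
  · simp [colWt, hk]

theorem colWt_of_notMem {F : Finset (Fin n)} {a : Fin n} (h : a ∉ F) : colWt F a = 0 := if_neg h

/-- The two monomials differ only in having `X_i` or `X_{i+1}`; the common remainder involves
neither variable and commutes with `T_i⁻¹`. -/
theorem TU_mul_Xpow_image {i : Fin (n - 1)} {F : Finset (Fin n)} (h₁ : hi i ∈ F) (h₂ : lo i ∉ F) :
    (TU i : AHA n) * Xpow (colWt (F.image (simple i))) =
      t • (Xpow (colWt F) * ((TU i)⁻¹ : (AHA n)ˣ).val) := by
  have hlo : lo i ∈ F.image (simple i) := by rwa [mem_image_simple, simple_lo]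
  have he : (F.image (simple i)).erase (lo i) = F.erase (hi i) := by
    ext k
    rw [Finset.mem_erase, Finset.mem_erase, mem_image_simple]
    by_cases hk₁ : k = lo i
    · subst hk₁
      simp [h₂]
    by_cases hk₂ : k = hi i
    · subst hk₂
      simp [h₂]
    rw [simple_of_ne hk₁ hk₂]
    simp [hk₁, hk₂]
  have hz : colWt (F.erase (hi i)) (lo i) = 0 := colWt_of_notMem (by simp [h₂])
  have hz' : colWt (F.erase (hi i)) (hi i) = 0 := colWt_of_notMem (by simp)
  rw [colWt_eq_single_add hlo, he, colWt_eq_single_add h₁, Xpow_add, Xpow_add, Xpow_single,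
    Xpow_single, ← mul_assoc, TU_mul_XU_lo, smul_mul_assoc, mul_assoc, mul_assoc,
    TU_inv_mul_Xpow_comm hz hz']

theorem fundWt_eq_colWt {F : Finset (Fin n)} (h : colPerm F = 1) : fundWt n F.card = colWt F := by
  funext k
  have := (isColPerm_colPerm F).mem_iff k
  rw [h, Equiv.Perm.one_apply] at this
  simp only [fundWt, colWt, this]

theorem Tw_colPerm_mul_Xpow (F : Finset (Fin n)) :
    (Tw (colPerm F) : AHA n) * Xpow (fundWt n F.card) = Xpow (colWt F) * colFactor F := by
  induction F using col_induction with
  | base F h => rw [fundWt_eq_colWt h, colFactor_of_eq_one h, h]; simp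
  | step i F h₁ h₂ ih =>
    rw [card_image_simple] at ih
    rw [colPerm_eq_simple_mul h₁ h₂, Tw_simple_mul (isAsc_colPerm_image h₁ h₂), Units.val_mul,
      mul_assoc, ih, ← mul_assoc, TU_mul_Xpow_image h₁ h₂, colFactor_eq h₁ h₂, smul_mul_assoc,
      mul_smul_comm, mul_assoc]

theorem fundWt_of_lt {ℓ : ℕ} {k : Fin n} (h : (k : ℕ) < ℓ) : fundWt n ℓ k = 1 := if_pos h

/-- Away from the cut, the exponents at `i` and `i + 1` are both `1` or both `0`, and `T_i` commutes
with the product `X_i X_{i+1}`. -/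
theorem TU_mul_Xpow_fundWt {ℓ : ℕ} {i : Fin (n - 1)} (h : (i : ℕ) + 1 ≠ ℓ) :
    (TU i : AHA n) * Xpow (fundWt n ℓ) = Xpow (fundWt n ℓ) * TU i := by
  by_cases hi' : (i : ℕ) + 1 < ℓ
  · set ν : Fin n → ℤ := fundWt n ℓ - (Pi.single (lo i) 1 + Pi.single (hi i) 1) with hν
    have e : fundWt n ℓ = Pi.single (lo i) 1 + Pi.single (hi i) 1 + ν := by rw [hν]; abel
    have h₁ : ν (lo i) = 0 := by
      rw [hν, Pi.sub_apply, Pi.add_apply, Pi.single_eq_same, Pi.single_eq_of_ne (lo_ne_hi i)]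
      rw [fundWt_of_lt (by simp only [lo]; omega)]
      norm_num
    have h₂ : ν (hi i) = 0 := by
      rw [hν, Pi.sub_apply, Pi.add_apply, Pi.single_eq_same, Pi.single_eq_of_ne (lo_ne_hi i).symm]
      rw [fundWt_of_lt (by simp only [hi]; omega)]
      norm_num
    rw [e, Xpow_add, Xpow_add, Xpow_single, Xpow_single, ← mul_assoc, TU_mul_XU_mul_XU, mul_assoc,
      TU_mul_Xpow_comm h₁ h₂, ← mul_assoc]
  · refine TU_mul_Xpow_comm ?_ ?_
    · exact if_neg (by simp only [lo]; omega)
    · exact if_neg (by simp only [hi]; omega)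

theorem mul_Xpow_fundWt {ℓ : ℕ} {g : AHA n} (hg : g ∈ parSubalgebra (fundWt n ℓ)) :
    g * Xpow (fundWt n ℓ) = Xpow (fundWt n ℓ) * g := by
  induction hg using Algebra.adjoin_induction with
  | mem x hx =>
    obtain ⟨w, hw, rfl⟩ := hx
    refine stab_induction (ℓ := ℓ)
      (p := fun w => (Tw w : AHA n) * Xpow (fundWt n ℓ) = Xpow (fundWt n ℓ) * (Tw w : AHA n))
      ?_ ?_ hw
    · simp
    · intro i w hi _ ha ih
      rw [Tw_simple_mul ha, Units.val_mul, mul_assoc, ih, ← mul_assoc, TU_mul_Xpow_fundWt hi,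
        mul_assoc]
  | algebraMap r => exact Algebra.commutes r _
  | add x y _ _ hx hy => rw [add_mul, mul_add, hx, hy]
  | mul x y _ _ hx hy => rw [mul_assoc, hy, ← mul_assoc, hx, mul_assoc]

end Monomials

/-! ### The elements `Ψ_T` -/

section Psi

variable {n : ℕ}

theorem card_le (C : Finset (Fin n)) : C.card ≤ n := by
  simpa using C.card_le_univ

theorem Psi_cons_mem_TSpan (C : Finset (Fin n)) (S : List (Finset (Fin n))) :
    Psi (C :: S) ∈ TSpan {x | Dominates (headSet C.card x) C} := by
  have hA : ∀ x ∈ {x | Dominates (headSet C.card x) C}, ∀ v ∈ stab n C.card,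
      x * v ∈ {x | Dominates (headSet C.card x) C} := fun x hx v hv => by
    rw [Set.mem_ofPred_eq, headSet_mul x hv]
    exact hx
  cases S with
  | nil => exact mul_mem_TSpan hA (colFactor_mem_TSpan C) (parSymmetrizer_mem n _)
  | cons D S => exact mul_mem_TSpan hA (colFactor_mem_TSpan C) (parCoeff_mem _ (mem_colSet.2 rfl))

theorem Psi_mem_TSpan_univ (T : List (Finset (Fin n))) : Psi T ∈ TSpan Set.univ := by
  cases T with
  | nil => exact sum_mem fun w _ => Tw_mem_TSpan (Set.mem_univ w)
  | cons C S => exact TSpan_mono (Set.subset_univ _) (Psi_cons_mem_TSpan C S)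

/-- This merges the two nonempty clauses of `Psi`, so that later arguments need not treat the first
column separately. -/
theorem exists_Psi_cons_eq {ℓ : ℕ} (hℓ : ℓ ≤ n) (T : List (Finset (Fin n))) :
    ∃ g, IsParDecomp ℓ (Psi T) g ∧ ∀ C ∈ colSet n ℓ, Psi (C :: T) = colFactor C * g C := by
  cases T with
  | nil =>
    refine ⟨_, isParDecomp_symmetrizer hℓ, fun C hC => ?_⟩
    rw [Psi, mem_colSet.1 hC]
  | cons D S =>
    refine ⟨_, isParDecomp_parCoeff hℓ (Psi_mem_TSpan_univ _), fun C hC => ?_⟩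
    rw [Psi, mem_colSet.1 hC]

theorem Xtab_singleton (C : Finset (Fin n)) : Xtab [C] = Xpow (colWt C) := by
  rw [Xtab]
  congr 1
  funext i
  by_cases h : i ∈ C <;> simp [colWt, h]

theorem Xtab_cons (C : Finset (Fin n)) (T : List (Finset (Fin n))) :
    Xtab (C :: T) = Xtab T * Xtab [C] := by
  rw [Xtab, Xtab, Xtab, ← Xpow_add]
  congr 1
  funext i
  simp only [Pi.add_apply, List.countP_cons, List.countP_nil]
  push_cast
  ring

theorem Psi_mul_Xpow {ℓ : ℕ} (hℓ : ℓ ≤ n) (T : List (Finset (Fin n))) :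
    Psi T * Xpow (fundWt n ℓ) = ∑ C ∈ colSet n ℓ, Xtab [C] * Psi (C :: T) := by
  obtain ⟨g, ⟨hg, hsum⟩, hΨ⟩ := exists_Psi_cons_eq hℓ T
  rw [hsum, Finset.sum_mul]
  refine Finset.sum_congr rfl fun C hC => ?_
  have := Tw_colPerm_mul_Xpow C
  rw [mem_colSet.1 hC] at this
  rw [hΨ C hC, mul_assoc, mul_Xpow_fundWt (hg C hC), ← mul_assoc, this, mul_assoc, Xtab_singleton]

theorem Psi_eq_zero {T : List (Finset (Fin n))} (hT : (T.map Finset.card).Pairwise (· ≥ ·))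
    (h : ¬ IsSemistandard T) : Psi T = 0 := by
  induction T with
  | nil => exact absurd List.Pairwise.nil h
  | cons C S ih =>
    cases S with
    | nil => exact absurd (List.pairwise_singleton _ _) h
    | cons D S =>
      rw [List.map_cons, List.pairwise_cons] at hT
      have hdec := isParDecomp_parCoeff (card_le C) (Psi_mem_TSpan_univ (D :: S))
      have hDC : D.card ≤ C.card := hT.1 _ (by simp)
      have hzero : parCoeff C.card (Psi (D :: S)) C = 0 := by
        by_cases hS : IsSemistandard (D :: S)
        · refine hdec.eq_zero (Psi_cons_mem_TSpan D S) rfl fun x hx he => h ?_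
          have hCD : RowLE C D := by
            -- The support condition for `D` concerns the first `D.card` values of `x`; since `C` is
            -- at least as long, its set of first values contains them.
            have := (Dominates.superset hx (headSet_mono hDC x)).rowLE
            rwa [he] at this
          refine List.pairwise_cons.2 ⟨fun E hE => ?_, hS⟩
          rcases List.mem_cons.1 hE with rfl | hE
          · exact hCD
          · rw [List.map_cons, List.pairwise_cons] at hT
            exact hCD.trans (hT.2.1 _ (List.mem_map_of_mem hE)) ((List.pairwise_cons.1 hS).1 E hE)
        -- Here `Ψ_{D⊗S} = 0` has empty support, so every coefficient vanishes, whichever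
        -- decomposition was chosen.
        · refine hdec.eq_zero (A := ∅) ?_ rfl fun x hx => absurd hx (Set.notMem_empty x)
          rw [ih hT.2 hS]
          exact zero_mem _
      rw [Psi, hzero, mul_zero]

/-! ### Sums over fillings and the columns of a diagram -/

theorem mem_tensorB {ls : List ℕ} {T : List (Finset (Fin n))} :
    T ∈ tensorB n ls ↔ T.map Finset.card = ls := by
  induction ls generalizing T with
  | nil => simp [tensorB]
  | cons ℓ ls ih =>
    simp only [tensorB, Finset.mem_image, Finset.mem_product, Prod.exists, mem_colSet, ih]
    constructor
    · rintro ⟨C, S, ⟨rfl, rfl⟩, rfl⟩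
      rfl
    · intro h
      cases T with
      | nil => simp at h
      | cons C S =>
        rw [List.map_cons, List.cons.injEq] at h
        exact ⟨C, S, h, rfl⟩

theorem symmetrizer_mul_Xpow_sum {ls : List ℕ} (h : ∀ ℓ ∈ ls, ℓ ≤ n) :
    symmetrizer n * Xpow (ls.map (fundWt n)).sum = ∑ T ∈ tensorB n ls, Xtab T * Psi T := by
  induction ls with
  | nil => simp [tensorB, Xpow_zero, Psi, Xtab, ← Pi.zero_def]
  | cons ℓ ls ih =>
    have hinj : Set.InjOn (fun p : Finset (Fin n) × List (Finset (Fin n)) => p.1 :: p.2)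
        (colSet n ℓ ×ˢ tensorB n ls : Finset _) := by
      rintro ⟨C, S⟩ _ ⟨D, S'⟩ _ h
      simpa using h
    rw [tensorB, Finset.sum_image hinj, Finset.sum_product_right, List.map_cons, List.sum_cons,
      add_comm, Xpow_add, ← mul_assoc, ih fun k hk => h k (List.mem_cons_of_mem _ hk),
      Finset.sum_mul]
    refine Finset.sum_congr rfl fun T _ => ?_
    rw [mul_assoc, Psi_mul_Xpow (h ℓ List.mem_cons_self), Finset.mul_sum]
    refine Finset.sum_congr rfl fun C _ => ?_
    rw [Xtab_cons C T, mul_assoc]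

theorem lt_card_filter_iff {lam : Fin n → ℕ} (h : Antitone lam) (j : ℕ) (i : Fin n) :
    (i : ℕ) < (Finset.univ.filter fun k => j < lam k).card ↔ j < lam i := by
  constructor
  · intro hi
    by_contra hc
    have hsub : (Finset.univ.filter fun k => j < lam k) ⊆ Finset.Iio i := fun k hk => by
      rw [Finset.mem_Iio]
      by_contra hk'
      have := h (not_lt.1 hk')
      have := (Finset.mem_filter.1 hk).2
      omega
    have := Finset.card_le_card hsub
    rw [Fin.card_Iio] at this
    omega
  · intro hj
    have hsub : Finset.Iic i ⊆ Finset.univ.filter fun k => j < lam k := fun k hk =>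
      Finset.mem_filter.2 ⟨Finset.mem_univ _, hj.trans_le (h (Finset.mem_Iic.1 hk))⟩
    have := Finset.card_le_card hsub
    rw [Fin.card_Iic] at this
    omega

/-- This is conjugation of partitions: column `j` reaches row `i` exactly when `j < lam i`, so row
`i` is counted `lam i` times. -/
theorem sum_fundWt_colLengths {lam : Fin n → ℕ} (h : Antitone lam) :
    ((colLengths lam).map (fundWt n)).sum = fun i => (lam i : ℤ) := by
  funext i
  have hle : lam i ≤ Finset.univ.sup lam := Finset.le_sup (Finset.mem_univ i)
  rw [colLengths, List.map_map]
  change (∑ j ∈ Finset.range (Finset.univ.sup lam),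
    fundWt n (Finset.univ.filter fun k => j < lam k).card) i = _
  rw [Finset.sum_apply]
  simp only [fundWt, lt_card_filter_iff h]
  rw [Finset.sum_boole]
  congr 1
  rw [show (Finset.range (Finset.univ.sup lam)).filter (fun j => j < lam i) =
    Finset.range (lam i) by ext j; simp only [Finset.mem_filter, Finset.mem_range]; omega,
    Finset.card_range]

theorem pairwise_colLengths (lam : Fin n → ℕ) : (colLengths lam).Pairwise (· ≥ ·) := by
  rw [colLengths, List.pairwise_map]
  refine List.pairwise_lt_range.imp fun {a b} hab => Finset.card_le_card fun k hk => ?_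
  rw [Finset.mem_filter] at hk ⊢
  exact ⟨hk.1, hab.trans hk.2⟩

end Psi

end HeckeLift

theorem theorem5p3 (n : ℕ) (hn : 0 < n) :
    (∀ ls : List ℕ, ls.Pairwise (· ≥ ·) → (∀ ℓ ∈ ls, 1 ≤ ℓ ∧ ℓ ≤ n) →
      ∀ T ∈ tensorB n ls,
        (¬ IsSemistandard T → Psi T = 0) ∧
        (∀ ℓ : ℕ, 1 ≤ ℓ → ℓ ≤ n →
          Psi T * Xpow (fundWt n ℓ) = ∑ C ∈ colSet n ℓ, Xtab [C] * Psi (C :: T))) ∧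
    (∀ lam : Fin n → ℕ, Antitone lam →
      symmetrizer n * Xpow (fun i => (lam i : ℤ)) = ∑ T ∈ ssyt lam, Xtab T * Psi T) := by
  classical
  refine ⟨fun ls hls _ T hT => ⟨Psi_eq_zero (by rwa [mem_tensorB.1 hT]),
    fun ℓ _ hℓ => Psi_mul_Xpow hℓ T⟩, fun lam hlam => ?_⟩
  rw [← sum_fundWt_colLengths hlam, symmetrizer_mul_Xpow_sum, ssyt]
  · refine (Finset.sum_subset (Finset.filter_subset _ _) fun T hT hT' => ?_).symm
    rw [Psi_eq_zero, mul_zero]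
    · rw [mem_tensorB.1 hT]
      exact pairwise_colLengths lam
    · exact fun hs => hT' (Finset.mem_filter.2 ⟨hT, hs⟩)
  · intro ℓ hℓ
    obtain ⟨j, -, rfl⟩ := List.mem_map.1 hℓ
    exact card_le _
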